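/- A **Galois structure** $\Gamma=(\mathscr C,\mathscr X,I,H,\eta,\epsilon,\mathcal E,\mathcal F)$ consists of an adjunction $I\dashv H$, $I\colon\mathscr C\to\mathscr X$, $H\colon\mathscr X\to\mathscr C$, with unit $\eta\colon 1_{\mathscr C}\Rightarrow HI$ and counit $\epsilon\colon IH\Rightarrow 1_{\mathscr X}$, and classes $\mathcal E$, $\mathcal F$ of morphisms of $\mathscr C$ and $\mathscr X$, respectively, each closed under composition and pullback (the pullback of a morphism of the class along any morphism exists and lies in the class) and containing all isomorphisms, such that $I(\mathcal E)\subseteq\mathcal F$ and $H(\mathcal F)\subseteq\mathcal E$. Morphisms in $\mathcal E$ are called *extensions*. For $B\in\mathscr C$, $(\mathscr C\downarrow_{\mathcal E}B)$ is the full subcategory of the slice category $(\mathscr C\downarrow B)$ on the extensions of $B$; similarly for $(\mathscr X\downarrow_{\mathcal F}Y)$. An extension $f\colon A\to B$ is * *trivial* if the naturality square $\eta_B\circ f=HI(f)\circ\eta_A$ is a pullback; * *monadic* if the change-of-base functor $f^*\colon(\mathscr C\downarrow_{\mathcal E}B)\to(\mathscr C\downarrow_{\mathcal E}A)$ is monadic;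 * *normal* if it is monadic and $f^*(f)$ is a trivial extension. Let $\mathrm{MExt}_{\mathcal E}(B)$ and $\mathrm{NExt}_\Gamma(B)$ be the full subcategories of $(\mathscr C\downarrow B)$ on the monadic and on the normal extensions of $B$, and let $\mathrm{MExt}_{\mathcal E}(\mathscr C)$ and $\mathrm{NExt}_\Gamma(\mathscr C)$ be the full subcategories of the arrow category of $\mathscr C$ on the monadic and on the normal extensions. A *weakly universal monadic extension* of $B$ is a weakly initial object $p\colon E\to B$ of $\mathrm{MExt}_{\mathcal E}(B)$, i.e. a monadic extension that factors through every monadic extension of $B$. $\Gamma$ is *admissible* if for every $B\in\mathscr C$ the functor $H^B\colon(\mathscr X\downarrow_{\mathcal F}I(B))\to(\mathscr C\downarrow_{\mathcal E}B)$, which sends $\varphi$ to the pullback of $H(\varphi)$ along $\eta_B$, is fully faithful. Write $\Gamma_{\mathrm{Split}}$ for the Galois structure with the same adjunction and with the classes $\mathrm{Split}(\mathcal E)$, $\mathrm{Split}(\mathcal F)$ of those morphisms in $\mathcal E$, $\mathcal F$ that are also split epimorphisms. **Proposition.** Let $\Gamma$ be a Galois structure such that 1. $I$ preserves every pullback square of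 morphisms $f\colon A\to B$ and $g\colon C\to B$ for which $f$ is a split epimorphism and $f,g\in\mathcal E$; 2. $\Gamma_{\mathrm{Split}}$ is admissible. If an object $B$ of $\mathscr C$ has a weakly universal monadic extension, then the inclusion functor $\mathrm{NExt}_\Gamma(B)\to\mathrm{MExt}_{\mathcal E}(B)$ has a left adjoint. If every object $B$ of $\mathscr C$ has a weakly universal monadic extension, and if monadic extensions are stable under pullback (along arbitrary morphisms), then the inclusion functor $\mathrm{NExt}_\Gamma(\mathscr C)\to\mathrm{MExt}_{\mathcal E}(\mathscr C)$ has a left adjoint. -/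

import Mathlib

open CategoryTheory CategoryTheory.Limits

universe v₁ v₂ u₁ u₂

/-- A Galois structure `(C, X, I, H, η, ε, E, F)`: an adjunction `I ⊣ H` (whose unit and counit
are `η` and `ε`) together with classes `E` and `F` of morphisms of `C` and `X`, each closed under
pullback and composition and containing all isomorphisms, with `I(E) ⊆ F` and `H(F) ⊆ E`.
Closure under pullback means: the pullback of a morphism of the class along an arbitrary morphism
exists, and is again in the class. -/
structure GaloisStructure (C : Type u₁) [Category.{v₁} C] (X : Type u₂) [Category.{v₂} X] where
  I : C ⥤ X
  H : X ⥤ C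
  adj : I ⊣ H
  E : MorphismProperty C
  F : MorphismProperty X
  hasPullbacks_E : E.HasPullbacks
  stable_E : E.IsStableUnderBaseChange
  comp_E : E.IsStableUnderComposition
  iso_E : MorphismProperty.isomorphisms C ≤ E
  hasPullbacks_F : F.HasPullbacks
  stable_F : F.IsStableUnderBaseChange
  comp_F : F.IsStableUnderComposition
  iso_F : MorphismProperty.isomorphisms X ≤ F
  map_I : ∀ ⦃A B : C⦄ (f : A ⟶ B), E f → F (I.map f)
  map_H : ∀ ⦃Y Z : X⦄ (g : Y ⟶ Z), F g → E (H.map g)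

/-- The class of split epimorphisms of a category. -/
def splitEpis (C : Type u₁) [Category.{v₁} C] : MorphismProperty C :=
  fun _ _ f => IsSplitEpi f

theorem splitEpis_isStableUnderBaseChange (C : Type u₁) [Category.{v₁} C] :
    (splitEpis C).IsStableUnderBaseChange where
  of_isPullback {_ _ _ _ f g f' g'} sq hg := by
    have : IsSplitEpi g := hg
    exact ⟨⟨sq.lift (f ≫ section_ g) (𝟙 _) (by simp), by simp⟩⟩

theorem splitEpis_isStableUnderComposition (C : Type u₁) [Category.{v₁} C] :
    (splitEpis C).IsStableUnderComposition where
  comp_mem f g hf hg := by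
    have : IsSplitEpi f := hf
    have : IsSplitEpi g := hg
    exact ⟨⟨section_ g ≫ section_ f, by simp⟩⟩

theorem isomorphisms_le_splitEpis (C : Type u₁) [Category.{v₁} C] :
    MorphismProperty.isomorphisms C ≤ splitEpis C := fun _ _ f hf => by
  have : IsIso f := hf
  exact (inferInstance : IsSplitEpi f)

theorem splitEpis_map {C : Type u₁} [Category.{v₁} C] {D : Type u₂} [Category.{v₂} D]
    (G : C ⥤ D) {A B : C} (f : A ⟶ B) (hf : splitEpis C f) : splitEpis D (G.map f) := by
  have : IsSplitEpi f := hf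
  exact (inferInstance : IsSplitEpi (G.map f))

namespace GaloisStructure

attribute [instance] hasPullbacks_E stable_E comp_E hasPullbacks_F stable_F comp_F

variable {C : Type u₁} [Category.{v₁} C] {X : Type u₂} [Category.{v₂} X]

/-- The induced structure `Γ_Split`, with the same adjunction and with the classes `Split(E)` and
`Split(F)` of those morphisms of `E` and `F` that are also split epimorphisms. -/
def split (Γ : GaloisStructure C X) : GaloisStructure C X where
  I := Γ.I
  H := Γ.H
  adj := Γ.adj
  E := Γ.E ⊓ splitEpis C
  F := Γ.F ⊓ splitEpis X
  hasPullbacks_E := ⟨fun _ h => MorphismProperty.HasPullbacks.hasPullback _ h.1⟩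
  stable_E := ⟨fun sq h => ⟨Γ.E.of_isPullback sq h.1,
    (splitEpis_isStableUnderBaseChange C).of_isPullback sq h.2⟩⟩
  comp_E := ⟨fun f g hf hg => ⟨Γ.E.comp_mem f g hf.1 hg.1,
    (splitEpis_isStableUnderComposition C).comp_mem f g hf.2 hg.2⟩⟩
  iso_E := fun _ _ f hf => ⟨Γ.iso_E f hf, isomorphisms_le_splitEpis C f hf⟩
  hasPullbacks_F := ⟨fun _ h => MorphismProperty.HasPullbacks.hasPullback _ h.1⟩
  stable_F := ⟨fun sq h => ⟨Γ.F.of_isPullback sq h.1,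
    (splitEpis_isStableUnderBaseChange X).of_isPullback sq h.2⟩⟩
  comp_F := ⟨fun f g hf hg => ⟨Γ.F.comp_mem f g hf.1 hg.1,
    (splitEpis_isStableUnderComposition X).comp_mem f g hf.2 hg.2⟩⟩
  iso_F := fun _ _ f hf => ⟨Γ.iso_F f hf, isomorphisms_le_splitEpis X f hf⟩
  map_I := fun _ _ f h => ⟨Γ.map_I f h.1, splitEpis_map Γ.I f h.2⟩
  map_H := fun _ _ g h => ⟨Γ.map_H g h.1, splitEpis_map Γ.H g h.2⟩

/-- `(C ↓_E B)`: the full subcategory of the slice category over `B` on the extensions of `B`. -/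
abbrev Ext (Γ : GaloisStructure C X) (B : C) := Γ.E.Over ⊤ B

/-- The change-of-base functor `f^* : (C ↓_E B) ⥤ (C ↓_E A)` along `f : A ⟶ B`. -/
noncomputable abbrev changeOfBase (Γ : GaloisStructure C X) {A B : C} (f : A ⟶ B) :
    Γ.Ext B ⥤ Γ.Ext A :=
  MorphismProperty.Over.pullback Γ.E ⊤ f

/-- The functor `(X ↓_F Y) ⥤ (C ↓_E H Y)` induced by `H`. -/
def overH (Γ : GaloisStructure C X) (Y : X) : Γ.F.Over ⊤ Y ⥤ Γ.Ext (Γ.H.obj Y) where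
  obj φ := MorphismProperty.Over.mk ⊤ (Γ.H.map φ.hom) (Γ.map_H _ φ.prop)
  map {φ ψ} g := MorphismProperty.Over.homMk (Γ.H.map g.left)
    ((Γ.H.map_comp _ _).symm.trans (congrArg Γ.H.map (MorphismProperty.Over.w g))) trivial

/-- The functor `H^B : (X ↓_F I B) ⥤ (C ↓_E B)`, sending `φ` to the pullback of `H φ` along the
unit `η_B : B ⟶ H I B`. -/
noncomputable def HB (Γ : GaloisStructure C X) (B : C) : Γ.F.Over ⊤ (Γ.I.obj B) ⥤ Γ.Ext B :=
  Γ.overH (Γ.I.obj B) ⋙ Γ.changeOfBase (Γ.adj.unit.app B)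

/-- A Galois structure is admissible when every functor `H^B` is fully faithful. -/
def IsAdmissible (Γ : GaloisStructure C X) : Prop :=
  ∀ B : C, (Γ.HB B).Full ∧ (Γ.HB B).Faithful

/-- The functor `I` preserves the pullback squares of `f` and `g` for which `f` is a split
epimorphism and both `f` and `g` are in `E`. -/
def PreservesSplitPullbacks (Γ : GaloisStructure C X) : Prop :=
  ∀ ⦃P A D B : C⦄ (fst : P ⟶ A) (snd : P ⟶ D) (f : A ⟶ B) (g : D ⟶ B),
    IsPullback fst snd f g → IsSplitEpi f → Γ.E f → Γ.E g →
      IsPullback (Γ.I.map fst) (Γ.I.map snd) (Γ.I.map f) (Γ.I.map g)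

/-- An extension `f : A ⟶ B` is trivial if the naturality square of the unit `η` at `f` is a
pullback. -/
def trivialExt (Γ : GaloisStructure C X) : MorphismProperty C := fun A B f =>
  Γ.E f ∧ IsPullback (Γ.adj.unit.app A) f (Γ.H.map (Γ.I.map f)) (Γ.adj.unit.app B)

/-- An extension `f : A ⟶ B` is monadic if `f^* : (C ↓_E B) ⥤ (C ↓_E A)` is monadic. -/
def monadicExt (Γ : GaloisStructure C X) : MorphismProperty C := fun _ _ f =>
  Γ.E f ∧ Nonempty (MonadicRightAdjoint (Γ.changeOfBase f))

/-- An extension `f` is normal if it is monadic and `f^*(f)` is a trivial extension. -/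
def normalExt (Γ : GaloisStructure C X) : MorphismProperty C := fun _ _ f =>
  Γ.monadicExt f ∧ ∃ hf : Γ.E f,
    Γ.trivialExt ((Γ.changeOfBase f).obj (MorphismProperty.Over.mk ⊤ f hf)).hom

theorem normalExt_le_monadicExt (Γ : GaloisStructure C X) : Γ.normalExt ≤ Γ.monadicExt :=
  fun _ _ _ h => h.1

/-- `MExt_E(B)`: the full subcategory of the slice category over `B` on the monadic extensions. -/
abbrev MExtOver (Γ : GaloisStructure C X) (B : C) :=
  (Γ.monadicExt.overObj : ObjectProperty (Over B)).FullSubcategory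

/-- `NExt_Γ(B)`: the full subcategory of the slice category over `B` on the normal extensions. -/
abbrev NExtOver (Γ : GaloisStructure C X) (B : C) :=
  (Γ.normalExt.overObj : ObjectProperty (Over B)).FullSubcategory

/-- The inclusion functor `NExt_Γ(B) ⥤ MExt_E(B)`. -/
abbrev inclOver (Γ : GaloisStructure C X) (B : C) : Γ.NExtOver B ⥤ Γ.MExtOver B :=
  ObjectProperty.ιOfLE fun f hf => Γ.normalExt_le_monadicExt f.hom hf

/-- The monadic extensions, as a class of objects of the arrow category of `C`. -/
def monadicArrow (Γ : GaloisStructure C X) : ObjectProperty (Arrow C) :=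
  fun f => Γ.monadicExt f.hom

/-- The normal extensions, as a class of objects of the arrow category of `C`. -/
def normalArrow (Γ : GaloisStructure C X) : ObjectProperty (Arrow C) :=
  fun f => Γ.normalExt f.hom

/-- `MExt_E(C)`: the full subcategory of the arrow category of `C` on the monadic extensions. -/
abbrev MExt (Γ : GaloisStructure C X) := Γ.monadicArrow.FullSubcategory

/-- `NExt_Γ(C)`: the full subcategory of the arrow category of `C` on the normal extensions. -/
abbrev NExt (Γ : GaloisStructure C X) := Γ.normalArrow.FullSubcategory

/-- The inclusion functor `NExt_Γ(C) ⥤ MExt_E(C)`. -/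
abbrev incl (Γ : GaloisStructure C X) : Γ.NExt ⥤ Γ.MExt :=
  ObjectProperty.ιOfLE fun f hf => Γ.normalExt_le_monadicExt f.hom hf

/-- A monadic extension `p : E ⟶ B` is weakly universal if it is a weakly initial object of
`MExt_E(B)`, i.e. if it factors through every monadic extension of `B`. -/
def IsWeaklyUniversal (Γ : GaloisStructure C X) {B : C} (p : Γ.MExtOver B) : Prop :=
  ∀ f : Γ.MExtOver B, Nonempty (p ⟶ f)

end GaloisStructure

/-! Write `p : E ⟶ B` for the weakly universal monadic extension and let `f : A ⟶ B` be monadic.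
Then `p` factors through `f`, so the base change `x = p^*(f)` is a split epimorphism. For split
extensions the hypotheses are strong: by admissibility of `Γ.split`, pulling `HI(x)` back along the
unit gives the reflection of `x` among trivial extensions of `E`, here called its trivialization.

The extension `f` amounts to `x` with its descent datum, carried by the Čech nerve of the base
change `b : P ⟶ A` of `p`, which lies over the nerve of `p` by pullback squares. Since `I` preserves
these squares, trivialization preserves them too, and the trivialized `x` inherits a descent datum.
Monadicity of `p` makes the datum effective: it comes from an extension `g` of `B`
(`exists_descent_trivObj`). A map from `f` to a normal extension `γ` corresponds to a map of descent
data from `x` to `p^*(γ)`. The latter is split and trivial, so the map extends uniquely to the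
trivialization and descends to a map from `g` to `γ` (`exists_normal_reflection`).

It remains to see that `g` is normal (`normalExt.of_isPullback_trivialExt`). It is monadic because
`p` factors through it (`monadicExt.of_comp`), and its kernel pair projection is trivial because it
becomes so after a conservative base change. Over a varying base, a map to a normal extension of
another object factors through a pullback of that extension, which is again normal. -/

namespace GaloisStructure

variable {C : Type u₁} [Category.{v₁} C] {X : Type u₂} [Category.{v₂} X]

/-! ### Monadicity in terms of pullback squares: conservativity and effective descent. -/

/-- Change of base along `p` reflects isomorphisms between extensions. -/
def IsConservative (Γ : GaloisStructure C X) {E B : C} (p : E ⟶ B) : Prop :=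
  ∀ ⦃Y Z Y' Z' : C⦄ ⦃y : Y ⟶ B⦄ ⦃z : Z ⟶ B⦄ ⦃y' : Y' ⟶ E⦄ ⦃z' : Z' ⟶ E⦄
    ⦃a : Y' ⟶ Y⦄ ⦃b : Z' ⟶ Z⦄ ⦃w : Y ⟶ Z⦄ ⦃w' : Y' ⟶ Z'⦄,
    Γ.E y → Γ.E z → w ≫ z = y → IsPullback a y' y p → IsPullback b z' z p →
    w' ≫ b = a ≫ w → w' ≫ z' = y' → IsIso w' → IsIso w

/-- Effectivity of descent along `p`: a pair of maps of extensions of `B` whose base change along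
`p` is part of a split coequalizer has a coequalizer, which is preserved by base change. -/
def IsEffective (Γ : GaloisStructure C X) {E B : C} (p : E ⟶ B) : Prop :=
  ∀ ⦃Y Z Y' Z' W : C⦄ ⦃y : Y ⟶ B⦄ ⦃z : Z ⟶ B⦄ ⦃y' : Y' ⟶ E⦄ ⦃z' : Z' ⟶ E⦄ ⦃w : W ⟶ E⦄
    ⦃a : Y' ⟶ Y⦄ ⦃b : Z' ⟶ Z⦄ ⦃f g : Y ⟶ Z⦄ ⦃f' g' : Y' ⟶ Z'⦄ ⦃π : Z' ⟶ W⦄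
    ⦃s : W ⟶ Z'⦄ ⦃t : Z' ⟶ Y'⦄,
    Γ.E y → Γ.E z → Γ.E w → f ≫ z = y → g ≫ z = y → IsPullback a y' y p → IsPullback b z' z p →
    f' ≫ b = a ≫ f → f' ≫ z' = y' → g' ≫ b = a ≫ g → g' ≫ z' = y' → π ≫ w = z' →
    s ≫ z' = w → t ≫ y' = z' → f' ≫ π = g' ≫ π → s ≫ π = 𝟙 W → t ≫ g' = 𝟙 Z' → t ≫ f' = π ≫ s →
    ∃ (N : C) (n : N ⟶ B) (ν : Z ⟶ N) (c : W ⟶ N), Γ.E n ∧ ν ≫ n = z ∧ f ≫ ν = g ≫ ν ∧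
      IsPullback c w n p ∧ π ≫ c = b ≫ ν ∧
      ∀ ⦃G : C⦄ (γ : G ⟶ B) (k : Z ⟶ G), Γ.E γ → k ≫ γ = z → f ≫ k = g ≫ k →
        ∃! l : N ⟶ G, ν ≫ l = k ∧ l ≫ γ = n

theorem hasPullback_of_E (Γ : GaloisStructure C X) {A B D : C} {f : A ⟶ B} (hf : Γ.E f)
    (g : D ⟶ B) : HasPullback f g :=
  MorphismProperty.HasPullbacks.hasPullback g hf

theorem exists_isPullback (Γ : GaloisStructure C X) {A B D : C} {f : A ⟶ B} (hf : Γ.E f)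
    (g : D ⟶ B) : ∃ (P : C) (fst : P ⟶ A) (snd : P ⟶ D), IsPullback fst snd f g :=
  have := Γ.hasPullback_of_E hf g
  ⟨_, _, _, IsPullback.of_hasPullback f g⟩

/-- The structure morphism of an extension of `B`. -/
def str (Γ : GaloisStructure C X) {B : C} (A : Γ.Ext B) : A.left ⟶ B :=
  A.hom

theorem left_str (Γ : GaloisStructure C X) {B : C} {A A' : Γ.Ext B} (f : A ⟶ A') :
    f.left ≫ Γ.str A' = Γ.str A :=
  MorphismProperty.Over.w f

/-- The projection from the base change of an extension to the extension itself. -/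
noncomputable def extProj (Γ : GaloisStructure C X) {E B : C} (p : E ⟶ B) (A : Γ.Ext B) :
    ((Γ.changeOfBase p).obj A).left ⟶ A.left :=
  pullback.fst A.hom p

theorem isPullback_extProj (Γ : GaloisStructure C X) {E B : C} (p : E ⟶ B) (A : Γ.Ext B) :
    IsPullback (Γ.extProj p A) (Γ.str ((Γ.changeOfBase p).obj A)) (Γ.str A) p :=
  IsPullback.of_hasPullback A.hom p

theorem changeOfBase_map_left_extProj (Γ : GaloisStructure C X) {E B : C} (p : E ⟶ B)
    {A A' : Γ.Ext B} (f : A ⟶ A') :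
    ((Γ.changeOfBase p).map f).left ≫ Γ.extProj p A' = Γ.extProj p A ≫ f.left :=
  pullback.lift_fst _ _ _

theorem exists_iso_changeOfBase (Γ : GaloisStructure C X) {E B : C} (p : E ⟶ B) {A : Γ.Ext B}
    {Y : C} {a : Y ⟶ A.left} {y : Y ⟶ E} (h : IsPullback a y (Γ.str A) p) :
    ∃ e : Y ≅ ((Γ.changeOfBase p).obj A).left, e.hom ≫ Γ.extProj p A = a ∧
      e.hom ≫ Γ.str ((Γ.changeOfBase p).obj A) = y :=
  ⟨h.isoIsPullback _ _ (Γ.isPullback_extProj p A), by simp, by simp⟩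

theorem changeOfBase_map_left_eq (Γ : GaloisStructure C X) {E B : C} (p : E ⟶ B)
    {A A' : Γ.Ext B} (f : A ⟶ A') {Y Y' : C} {a : Y ⟶ A.left} {y : Y ⟶ E} {a' : Y' ⟶ A'.left}
    {y' : Y' ⟶ E} (e : Y ≅ ((Γ.changeOfBase p).obj A).left)
    (e' : Y' ≅ ((Γ.changeOfBase p).obj A').left) (he : e.hom ≫ Γ.extProj p A = a)
    (hy : e.hom ≫ Γ.str ((Γ.changeOfBase p).obj A) = y) (he' : e'.hom ≫ Γ.extProj p A' = a')
    (hy' : e'.hom ≫ Γ.str ((Γ.changeOfBase p).obj A') = y') {w : Y ⟶ Y'}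
    (hw : w ≫ a' = a ≫ f.left) (hw' : w ≫ y' = y) :
    ((Γ.changeOfBase p).map f).left = e.inv ≫ w ≫ e'.hom := by
  rw [Iso.eq_inv_comp]
  apply (Γ.isPullback_extProj p A').hom_ext
  · rw [Category.assoc, changeOfBase_map_left_extProj, Category.assoc, he', hw,
      reassoc_of% he]
  · rw [Category.assoc, left_str, Category.assoc, hy', hw', hy]

theorem isIso_left_iff (Γ : GaloisStructure C X) {B : C} {A A' : Γ.Ext B} (f : A ⟶ A') :
    IsIso f.left ↔ IsIso f :=
  ⟨fun h => by
    have : IsIso ((MorphismProperty.Over.forget _ _ _ ⋙ Over.forget _).map f) := h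
    exact isIso_of_reflects_iso f (MorphismProperty.Over.forget _ _ _ ⋙ Over.forget _),
  fun h => inferInstanceAs
    (IsIso ((MorphismProperty.Over.forget _ _ _ ⋙ Over.forget _).map f))⟩

theorem reflectsIsomorphisms_changeOfBase_iff (Γ : GaloisStructure C X) {E B : C} (p : E ⟶ B) :
    (Γ.changeOfBase p).ReflectsIsomorphisms ↔ Γ.IsConservative p := by
  constructor
  · intro h Y Z Y' Z' y z y' z' a b w w' hy hz hw hY hZ hab hw' hi
    let w₁ : (MorphismProperty.Over.mk ⊤ y hy : Γ.Ext B) ⟶ MorphismProperty.Over.mk ⊤ z hz :=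
      MorphismProperty.Over.homMk w hw trivial
    obtain ⟨e₁, he₁, he₁'⟩ := Γ.exists_iso_changeOfBase p
      (A := MorphismProperty.Over.mk ⊤ y hy) hY
    obtain ⟨e₂, he₂, he₂'⟩ := Γ.exists_iso_changeOfBase p
      (A := MorphismProperty.Over.mk ⊤ z hz) hZ
    have e := Γ.changeOfBase_map_left_eq p w₁ e₁ e₂ he₁ he₁' he₂ he₂' hab hw'
    have : IsIso ((Γ.changeOfBase p).map w₁) := by
      rw [← isIso_left_iff, e]
      infer_instance
    exact (Γ.isIso_left_iff w₁).2 (isIso_of_reflects_iso w₁ (Γ.changeOfBase p))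
  · intro h
    refine ⟨fun {Y Z} w hw => (Γ.isIso_left_iff w).1 ?_⟩
    exact h Y.prop Z.prop (MorphismProperty.Over.w w) (Γ.isPullback_extProj p Y)
      (Γ.isPullback_extProj p Z) (Γ.changeOfBase_map_left_extProj p w)
      (MorphismProperty.Over.w _) ((Γ.isIso_left_iff _).2 hw)

theorem monadicExt.isConservative {Γ : GaloisStructure C X} {E B : C} {p : E ⟶ B}
    (hp : Γ.monadicExt p) : Γ.IsConservative p := by
  rw [← reflectsIsomorphisms_changeOfBase_iff]
  obtain ⟨h⟩ := hp.2
  have := h.eqv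
  have e : Monad.comparison (monadicAdjunction (Γ.changeOfBase p)) ⋙
    (monadicAdjunction (Γ.changeOfBase p)).toMonad.forget = Γ.changeOfBase p := rfl
  rw [← e]
  infer_instance

theorem IsConservative.of_isPullback {Γ : GaloisStructure C X} {E B N N' : C} {p : E ⟶ B}
    (hp : Γ.IsConservative p) {n : N ⟶ B} (hn : Γ.E n) {p' : N' ⟶ N} {n' : N' ⟶ E}
    (sq : IsPullback p' n' n p) : Γ.IsConservative p' := by
  intro Y Z Y' Z' y z y' z' a b w w' hy hz hw hY hZ hab hw' hi
  exact hp (Γ.E.comp_mem y n hy hn) (Γ.E.comp_mem z n hz hn) (by rw [← hw, Category.assoc])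
    (hY.paste_vert sq) (hZ.paste_vert sq) hab (by rw [← hw', Category.assoc]) hi

/-- This is the necessity half of Beck's theorem: a monadic functor creates coequalizers of pairs
that it sends to split pairs. -/
theorem monadicExt.exists_coequalizer {Γ : GaloisStructure C X} {E B : C} {p : E ⟶ B}
    (hp : Γ.monadicExt p) {Y Z : Γ.Ext B} (f g : Y ⟶ Z) {W : Γ.Ext E}
    (π : (Γ.changeOfBase p).obj Z ⟶ W)
    (h : IsSplitCoequalizer ((Γ.changeOfBase p).map f) ((Γ.changeOfBase p).map g) π) :
    ∃ (N : Γ.Ext B) (ν : Z ⟶ N) (c : W ⟶ (Γ.changeOfBase p).obj N), f ≫ ν = g ≫ ν ∧ IsIso c ∧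
      π ≫ c = (Γ.changeOfBase p).map ν ∧
      ∀ (G : Γ.Ext B) (k : Z ⟶ G), f ≫ k = g ≫ k → ∃! l : N ⟶ G, ν ≫ l = k := by
  have hsp : (Γ.changeOfBase p).IsSplitPair f g := ⟨_, _, ⟨h⟩⟩
  obtain ⟨hm⟩ := hp.2
  let := Monad.createsGSplitCoequalizersOfMonadic (Γ.changeOfBase p) f g
  have : HasCoequalizer ((Γ.changeOfBase p).map f) ((Γ.changeOfBase p).map g) := inferInstance
  have : HasColimit (parallelPair f g ⋙ Γ.changeOfBase p) := by
    rw [hasColimit_iff_of_iso (diagramIsoParallelPair.{v₁} _)]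
    exact this
  have : HasCoequalizer f g := hasColimit_of_created (parallelPair f g) (Γ.changeOfBase p)
  have hc := isColimitOfHasCoequalizerOfPreservesColimit (Γ.changeOfBase p) f g
  let e := h.isCoequalizer.coconePointUniqueUpToIso hc
  refine ⟨coequalizer f g, coequalizer.π f g, e.hom, coequalizer.condition f g, e.isIso_hom,
    h.isCoequalizer.comp_coconePointUniqueUpToIso_hom hc WalkingParallelPair.one,
    fun G k hk => ⟨coequalizer.desc k hk, coequalizer.π_desc k hk, fun l hl => ?_⟩⟩
  apply coequalizer.hom_ext
  rw [coequalizer.π_desc, hl]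

/-- Frees the previous result from chosen pullbacks: the splitting data are conjugated by the
isomorphisms `iY` and `iZ` onto the chosen base changes. -/
theorem monadicExt.exists_coequalizer_of_isPullback {Γ : GaloisStructure C X} {E B : C} {p : E ⟶ B}
    (hp : Γ.monadicExt p) {Y Z : Γ.Ext B} (f g : Y ⟶ Z) (W : Γ.Ext E) {Y' Z' : C}
    {y' : Y' ⟶ E} {z' : Z' ⟶ E} {a : Y' ⟶ Y.left} {b : Z' ⟶ Z.left} {f' g' : Y' ⟶ Z'}
    {π : Z' ⟶ W.left} {s : W.left ⟶ Z'} {t : Z' ⟶ Y'}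
    (hY : IsPullback a y' (Γ.str Y) p) (hZ : IsPullback b z' (Γ.str Z) p)
    (hf'b : f' ≫ b = a ≫ f.left) (hf'z : f' ≫ z' = y') (hg'b : g' ≫ b = a ≫ g.left)
    (hg'z : g' ≫ z' = y') (hπ : π ≫ Γ.str W = z') (hs : s ≫ z' = Γ.str W) (ht : t ≫ y' = z')
    (hfg : f' ≫ π = g' ≫ π) (hsπ : s ≫ π = 𝟙 W.left) (htg : t ≫ g' = 𝟙 Z')
    (htf : t ≫ f' = π ≫ s) :
    ∃ (N : Γ.Ext B) (ν : Z ⟶ N) (c : W.left ⟶ N.left), f ≫ ν = g ≫ ν ∧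
      IsPullback c (Γ.str W) (Γ.str N) p ∧ π ≫ c = b ≫ ν.left ∧
      ∀ (G : Γ.Ext B) (k : Z ⟶ G), f ≫ k = g ≫ k → ∃! l : N ⟶ G, ν ≫ l = k := by
  obtain ⟨iY, hiYa, hiY⟩ := Γ.exists_iso_changeOfBase p hY
  obtain ⟨iZ, hiZb, hiZ⟩ := Γ.exists_iso_changeOfBase p hZ
  have ef := Γ.changeOfBase_map_left_eq p f iY iZ hiYa hiY hiZb hiZ hf'b hf'z
  have eg := Γ.changeOfBase_map_left_eq p g iY iZ hiYa hiY hiZb hiZ hg'b hg'z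
  have hiZ' : iZ.inv ≫ z' = Γ.str ((Γ.changeOfBase p).obj Z) := by
    rw [Iso.inv_comp_eq, hiZ]
  let π₁ : (Γ.changeOfBase p).obj Z ⟶ W :=
    MorphismProperty.Over.homMk (iZ.inv ≫ π)
      (show (iZ.inv ≫ π) ≫ Γ.str W = _ by rw [Category.assoc, hπ, hiZ']; rfl) trivial
  let s₁ : W ⟶ (Γ.changeOfBase p).obj Z :=
    MorphismProperty.Over.homMk (s ≫ iZ.hom)
      (show (s ≫ iZ.hom) ≫ Γ.str _ = _ by rw [Category.assoc, hiZ, hs]; rfl) trivial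
  let t₁ : (Γ.changeOfBase p).obj Z ⟶ (Γ.changeOfBase p).obj Y :=
    MorphismProperty.Over.homMk (iZ.inv ≫ t ≫ iY.hom)
      (show (iZ.inv ≫ t ≫ iY.hom) ≫ Γ.str _ = _ by
        rw [Category.assoc, Category.assoc, hiY, ht, hiZ']; rfl) trivial
  have hπ₁ : π₁.left = iZ.inv ≫ π := rfl
  have hs₁ : s₁.left = s ≫ iZ.hom := rfl
  have ht₁ : t₁.left = iZ.inv ≫ t ≫ iY.hom := rfl
  have split : IsSplitCoequalizer ((Γ.changeOfBase p).map f) ((Γ.changeOfBase p).map g) π₁ :=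
    { rightSection := s₁
      leftSection := t₁
      condition := by
        ext
        rw [MorphismProperty.Comma.comp_left, MorphismProperty.Comma.comp_left, ef, eg, hπ₁]
        simp [hfg]
      rightSection_π := by
        ext
        rw [MorphismProperty.Comma.comp_left, hs₁, hπ₁]
        simpa using hsπ
      leftSection_bottom := by
        ext
        rw [MorphismProperty.Comma.comp_left, eg, ht₁]
        simp only [Category.assoc, Iso.hom_inv_id_assoc, reassoc_of% htg]
        exact iZ.inv_hom_id
      leftSection_top := by
        ext
        rw [MorphismProperty.Comma.comp_left, MorphismProperty.Comma.comp_left, ef, ht₁, hπ₁, hs₁]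
        simp [reassoc_of% htf] }
  obtain ⟨N, ν, c, hν, hc, hπc, hN⟩ := hp.exists_coequalizer f g π₁ split
  refine ⟨N, ν, c.left ≫ Γ.extProj p N, hν, ?_, ?_, hN⟩
  · have := (Γ.isIso_left_iff c).2 hc
    refine IsPullback.of_iso' (Γ.isPullback_extProj p N) (asIso c.left) (Iso.refl _)
      (Iso.refl _) (Iso.refl _) ?_ ?_ ?_ ?_
    · simp
    · rw [asIso_hom, Γ.left_str c]
      simp
    · simp
    · simp
  · have h₁ : π₁.left ≫ c.left = ((Γ.changeOfBase p).map ν).left :=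
      congrArg (fun m => m.left) hπc
    have h₂ := Γ.changeOfBase_map_left_extProj p ν
    rw [← h₁, hπ₁] at h₂
    simp only [Category.assoc] at h₂
    rw [Iso.inv_comp_eq, reassoc_of% hiZb] at h₂
    exact h₂

theorem monadicExt.isEffective {Γ : GaloisStructure C X} {E B : C} {p : E ⟶ B}
    (hp : Γ.monadicExt p) : Γ.IsEffective p := by
  intro Y Z Y' Z' W y z y' z' w a b f g f' g' π s t hy hz hw hf hg hY hZ hf'b hf'z hg'b hg'z hπ hs ht
    hfg hsπ htg htf
  let f₁ : (MorphismProperty.Over.mk ⊤ y hy : Γ.Ext B) ⟶ MorphismProperty.Over.mk ⊤ z hz :=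
    MorphismProperty.Over.homMk f hf trivial
  let g₁ : (MorphismProperty.Over.mk ⊤ y hy : Γ.Ext B) ⟶ MorphismProperty.Over.mk ⊤ z hz :=
    MorphismProperty.Over.homMk g hg trivial
  obtain ⟨N, ν, c, hν, hc, hπc, hN⟩ := hp.exists_coequalizer_of_isPullback f₁ g₁
    (MorphismProperty.Over.mk ⊤ w hw) hY hZ hf'b hf'z hg'b hg'z hπ hs ht hfg hsπ htg htf
  refine ⟨N.left, N.hom, ν.left, c, N.prop, MorphismProperty.Over.w ν,
    congrArg (fun m => m.left) hν, hc, hπc, fun G γ k hγ hk hfk => ?_⟩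
  let k₁ : (MorphismProperty.Over.mk ⊤ z hz : Γ.Ext B) ⟶ MorphismProperty.Over.mk ⊤ γ hγ :=
    MorphismProperty.Over.homMk k hk trivial
  have hk₁ : f₁ ≫ k₁ = g₁ ≫ k₁ := by
    ext
    exact hfk
  obtain ⟨l, hl, hl'⟩ := hN _ k₁ hk₁
  refine ⟨l.left, ⟨congrArg (fun m => m.left) hl, MorphismProperty.Over.w l⟩, ?_⟩
  rintro m ⟨hm, hm'⟩
  let m₁ : N ⟶ MorphismProperty.Over.mk ⊤ γ hγ := MorphismProperty.Over.homMk m hm' trivial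
  exact congrArg (fun m => m.left) (hl' m₁ (by ext; exact hm))

/-! ### Right cancellation of monadic extensions. -/

/-- Split coequalizers are absolute. -/
theorem preservesColimit_parallelPair_comp {D₁ D₂ D₃ : Type*} [Category* D₁] [Category* D₂]
    [Category* D₃] (F : D₁ ⥤ D₂) (G : D₂ ⥤ D₃) {Y Z : D₁} (f g : Y ⟶ Z) [F.IsSplitPair f g] :
    PreservesColimit (parallelPair f g ⋙ F) G := by
  have : PreservesColimit (parallelPair (F.map f) (F.map g)) G :=
    preservesColimit_of_preserves_colimit_cocone
      (HasSplitCoequalizer.isSplitCoequalizer (F.map f) (F.map g)).isCoequalizer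
      ((isColimitMapCoconeCoforkEquiv G _).symm
        ((HasSplitCoequalizer.isSplitCoequalizer (F.map f) (F.map g)).map G).isCoequalizer)
  have e : parallelPair (F.map f) (F.map g) ≅ parallelPair f g ⋙ F :=
    (diagramIsoParallelPair (parallelPair f g ⋙ F)).symm
  exact preservesColimit_of_iso_diagram _ e

/-- Beck's criterion for `n^*`. Since `(q ≫ n)^*` is `n^*` followed by `q^*`, conservativity and the
existence of coequalizers of `n^*`-split pairs come from `q ≫ n`. Only preservation by `n^*` needs
more: it is tested after base change along the pullback `p'` of `q ≫ n` along `n`. -/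
theorem monadicExt.of_comp {Γ : GaloisStructure C X} {E B N : C} {q : E ⟶ N} {n : N ⟶ B}
    (hp : Γ.monadicExt (q ≫ n)) (hn : Γ.E n) : Γ.monadicExt n := by
  refine ⟨hn, ?_⟩
  let e : Γ.changeOfBase (q ≫ n) ≅ Γ.changeOfBase n ⋙ Γ.changeOfBase q :=
    MorphismProperty.Over.pullbackComp q n
  obtain ⟨N', p', n', sq⟩ := Γ.exists_isPullback hn (q ≫ n)
  have hp' : (Γ.changeOfBase p').ReflectsIsomorphisms :=
    (Γ.reflectsIsomorphisms_changeOfBase_iff p').2 (hp.isConservative.of_isPullback hn sq)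
  let e' : Γ.changeOfBase n ⋙ Γ.changeOfBase p' ≅
      Γ.changeOfBase (q ≫ n) ⋙ Γ.changeOfBase n' :=
    (MorphismProperty.Over.pullbackComp p' n).symm ≪≫
      MorphismProperty.Over.pullbackCongr sq.w ≪≫ MorphismProperty.Over.pullbackComp n' (q ≫ n)
  have hr : (Γ.changeOfBase (q ≫ n)).ReflectsIsomorphisms :=
    (Γ.reflectsIsomorphisms_changeOfBase_iff _).2 hp.isConservative
  have hr' : (Γ.changeOfBase n).ReflectsIsomorphisms := by
    refine ⟨fun w hw => ?_⟩
    have : IsIso ((Γ.changeOfBase n ⋙ Γ.changeOfBase q).map w) :=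
      inferInstanceAs (IsIso ((Γ.changeOfBase q).map _))
    have := (NatIso.isIso_map_iff e w).2 this
    exact isIso_of_reflects_iso w (Γ.changeOfBase (q ≫ n))
  obtain ⟨hm⟩ := hp.2
  have key : ∀ {Y Z : Γ.Ext B} (f g : Y ⟶ Z) [(Γ.changeOfBase n).IsSplitPair f g],
      HasCoequalizer f g ∧ PreservesColimit (parallelPair f g) (Γ.changeOfBase n) := by
    intro Y Z f g hs
    have hsp : (Γ.changeOfBase (q ≫ n)).IsSplitPair f g := by
      obtain ⟨W, π, ⟨h⟩⟩ := hs
      have h' := h.map (Γ.changeOfBase q)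
      have hf := e.hom.naturality f
      have hg := e.hom.naturality g
      have hf' := e.inv.naturality f
      have hg' := e.inv.naturality g
      refine ⟨_, e.hom.app Z ≫ (Γ.changeOfBase q).map π, ⟨
        { rightSection := h'.rightSection ≫ e.inv.app Z
          leftSection := e.hom.app Z ≫ h'.leftSection ≫ e.inv.app Y
          condition := ?_
          rightSection_π := ?_
          leftSection_bottom := ?_
          leftSection_top := ?_ }⟩⟩
      · rw [reassoc_of% hf, reassoc_of% hg]
        exact congrArg _ h'.condition
      · rw [Category.assoc, e.inv_hom_id_app_assoc]
        exact h'.rightSection_π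
      · rw [Category.assoc, Category.assoc, ← hg']
        have := h'.leftSection_bottom
        dsimp only [Functor.comp_map]
        rw [reassoc_of% this, e.hom_inv_id_app]
      · rw [Category.assoc, Category.assoc, ← hf', Category.assoc]
        have := h'.leftSection_top
        dsimp only [Functor.comp_map]
        rw [reassoc_of% this]
    let := Monad.createsGSplitCoequalizersOfMonadic (Γ.changeOfBase (q ≫ n)) f g
    have : HasCoequalizer ((Γ.changeOfBase (q ≫ n)).map f) ((Γ.changeOfBase (q ≫ n)).map g) :=
      inferInstance
    have : HasColimit (parallelPair f g ⋙ Γ.changeOfBase (q ≫ n)) := by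
      rw [hasColimit_iff_of_iso (diagramIsoParallelPair.{v₁} _)]
      exact this
    have hc : HasCoequalizer f g :=
      hasColimit_of_created (parallelPair f g) (Γ.changeOfBase (q ≫ n))
    refine ⟨hc, ?_⟩
    have : HasCoequalizer ((Γ.changeOfBase n).map f) ((Γ.changeOfBase n).map g) := inferInstance
    have : HasColimit (parallelPair f g ⋙ Γ.changeOfBase n) := by
      rw [hasColimit_iff_of_iso (diagramIsoParallelPair.{v₁} _)]
      exact this
    have : PreservesColimit (parallelPair f g ⋙ Γ.changeOfBase n) (Γ.changeOfBase p') :=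
      preservesColimit_parallelPair_comp _ _ f g
    have : PreservesColimit (parallelPair f g ⋙ Γ.changeOfBase (q ≫ n)) (Γ.changeOfBase n') :=
      preservesColimit_parallelPair_comp _ _ f g
    -- Up to isomorphism this composite is `(q ≫ n)^*`, which preserves the coequalizer, followed by
    -- `n'^*`, which preserves its absolute image. As `p'^*` is conservative and preserves the
    -- coequalizer of the `n^*`-images, it also reflects it.
    have : PreservesColimit (parallelPair f g) (Γ.changeOfBase n ⋙ Γ.changeOfBase p') :=
      preservesColimit_of_natIso _ e'.symm
    have : ReflectsColimit (parallelPair f g ⋙ Γ.changeOfBase n) (Γ.changeOfBase p') :=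
      reflectsColimit_of_reflectsIsomorphisms _ _
    exact preservesColimit_of_reflects_of_preserves (Γ.changeOfBase n) (Γ.changeOfBase p')
  have : Monad.HasCoequalizerOfIsSplitPair (Γ.changeOfBase n) := ⟨fun f g _ => (key f g).1⟩
  have : Monad.PreservesColimitOfIsSplitPair (Γ.changeOfBase n) := ⟨fun f g _ => (key f g).2⟩
  exact ⟨Monad.monadicOfHasPreservesGSplitCoequalizersOfReflectsIsomorphisms
    (MorphismProperty.Over.mapPullbackAdj Γ.E ⊤ n hn trivial)⟩

/-! ### Čech nerves and descent of morphisms. -/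

/-- The first stages of the Čech nerve of a morphism `b : P ⟶ A`: its kernel pair
`q₀, q₁ : Q ⟶ P` and the triple fibre product `R`, with the three projections `R ⟶ Q`. -/
structure CechNerve {P A : C} (b : P ⟶ A) where
  Q : C
  R : C
  q₀ : Q ⟶ P
  q₁ : Q ⟶ P
  r₀₁ : R ⟶ Q
  r₀₂ : R ⟶ Q
  r₁₂ : R ⟶ Q
  isPullback_Q : IsPullback q₀ q₁ b b
  isPullback_R : IsPullback r₀₂ r₁₂ q₁ q₁
  r₀₁_q₀ : r₀₁ ≫ q₀ = r₀₂ ≫ q₀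
  r₀₁_q₁ : r₀₁ ≫ q₁ = r₁₂ ≫ q₀

namespace CechNerve

theorem nonempty (Γ : GaloisStructure C X) {P A : C} {b : P ⟶ A} (hb : Γ.E b) :
    Nonempty (CechNerve b) := by
  obtain ⟨Q, q₀, q₁, hQ⟩ := Γ.exists_isPullback hb b
  have hq : Γ.E q₁ := Γ.E.of_isPullback hQ hb
  obtain ⟨R, r₀₂, r₁₂, hR⟩ := Γ.exists_isPullback hq q₁
  refine ⟨⟨Q, R, q₀, q₁, hQ.lift (r₀₂ ≫ q₀) (r₁₂ ≫ q₀) ?_, r₀₂, r₁₂, hQ, hR, hQ.lift_fst _ _ _,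
    hQ.lift_snd _ _ _⟩⟩
  rw [Category.assoc, Category.assoc, hQ.w, reassoc_of% hR.w]

variable {P A E B : C} {b : P ⟶ A} {p : E ⟶ B} (n : CechNerve b) (m : CechNerve p)

/-- Décalage: a triple `(x₀, x₁, x₂)` is a pair `(x₀, x₁)` together with a point `x₂` in the same
fibre. Hence `R` is the base change of `Q` along `b`. -/
theorem isPullback_dec : IsPullback n.r₀₁ (n.r₁₂ ≫ n.q₁) (n.q₁ ≫ b) b := by
  have hQ := n.isPullback_Q
  have hR := n.isPullback_R
  have w : n.r₀₁ ≫ n.q₁ ≫ b = (n.r₁₂ ≫ n.q₁) ≫ b := by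
    rw [reassoc_of% n.r₀₁_q₁, Category.assoc, hQ.w]
  refine ⟨⟨w⟩, ⟨PullbackCone.IsLimit.mk _ (fun s => hR.lift
    (hQ.lift (s.fst ≫ n.q₀) s.snd (by rw [Category.assoc, hQ.w, s.condition]))
    (hQ.lift (s.fst ≫ n.q₁) s.snd (by rw [Category.assoc, s.condition])) (by simp)) ?_ ?_ ?_⟩⟩
  · intro s
    apply hQ.hom_ext
    · rw [Category.assoc, n.r₀₁_q₀, hR.lift_fst_assoc, hQ.lift_fst]
    · rw [Category.assoc, n.r₀₁_q₁, hR.lift_snd_assoc, hQ.lift_fst]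
  · intro s
    rw [hR.lift_snd_assoc, hQ.lift_snd]
  · intro s l h₁ h₂
    apply hR.hom_ext
    · rw [hR.lift_fst]
      apply hQ.hom_ext
      · rw [hQ.lift_fst, Category.assoc, ← n.r₀₁_q₀, reassoc_of% h₁]
      · rw [hQ.lift_snd, Category.assoc, hR.w, h₂]
    · rw [hR.lift_snd]
      apply hQ.hom_ext
      · rw [hQ.lift_fst, Category.assoc, ← n.r₀₁_q₁, reassoc_of% h₁]
      · rw [hQ.lift_snd, Category.assoc, h₂]

/-- The diagonal `P ⟶ Q`. -/
noncomputable def s : P ⟶ n.Q := n.isPullback_Q.lift (𝟙 P) (𝟙 P) rfl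

theorem s_q₀ : n.s ≫ n.q₀ = 𝟙 P := n.isPullback_Q.lift_fst _ _ _

theorem s_q₁ : n.s ≫ n.q₁ = 𝟙 P := n.isPullback_Q.lift_snd _ _ _

/-- The extra degeneracy `(x₀, x₁) ↦ (x₁, x₀, x₁)`. -/
noncomputable def t : n.Q ⟶ n.R :=
  n.isPullback_R.lift (n.q₁ ≫ n.s) (𝟙 n.Q) (by rw [Category.assoc, s_q₁]; simp)

theorem t_r₀₂ : n.t ≫ n.r₀₂ = n.q₁ ≫ n.s := n.isPullback_R.lift_fst _ _ _

theorem t_r₁₂ : n.t ≫ n.r₁₂ = 𝟙 n.Q := n.isPullback_R.lift_snd _ _ _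

variable {x : P ⟶ E} {a : A ⟶ B} (h : b ≫ a = x ≫ p)

/-- The morphism induced on kernel pairs by a commutative square. -/
noncomputable def mapQ : n.Q ⟶ m.Q :=
  m.isPullback_Q.lift (n.q₀ ≫ x) (n.q₁ ≫ x) (by
    rw [Category.assoc, Category.assoc, ← h, reassoc_of% n.isPullback_Q.w])

theorem mapQ_q₀ : n.mapQ m h ≫ m.q₀ = n.q₀ ≫ x := m.isPullback_Q.lift_fst _ _ _

theorem mapQ_q₁ : n.mapQ m h ≫ m.q₁ = n.q₁ ≫ x := m.isPullback_Q.lift_snd _ _ _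

theorem s_mapQ : n.s ≫ n.mapQ m h = x ≫ m.s := by
  apply m.isPullback_Q.hom_ext
  · rw [Category.assoc, Category.assoc, mapQ_q₀, m.s_q₀, reassoc_of% n.s_q₀, Category.comp_id]
  · rw [Category.assoc, Category.assoc, mapQ_q₁, m.s_q₁, reassoc_of% n.s_q₁, Category.comp_id]

/-- The morphism induced on triple fibre products by a commutative square. -/
noncomputable def mapR : n.R ⟶ m.R :=
  m.isPullback_R.lift (n.r₀₂ ≫ n.mapQ m h) (n.r₁₂ ≫ n.mapQ m h) (by
    rw [Category.assoc, Category.assoc, mapQ_q₁, reassoc_of% n.isPullback_R.w])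

theorem mapR_r₀₂ : n.mapR m h ≫ m.r₀₂ = n.r₀₂ ≫ n.mapQ m h := m.isPullback_R.lift_fst _ _ _

theorem mapR_r₁₂ : n.mapR m h ≫ m.r₁₂ = n.r₁₂ ≫ n.mapQ m h := m.isPullback_R.lift_snd _ _ _

theorem mapR_r₀₁ : n.mapR m h ≫ m.r₀₁ = n.r₀₁ ≫ n.mapQ m h := by
  apply m.isPullback_Q.hom_ext
  · rw [Category.assoc, Category.assoc, m.r₀₁_q₀, mapQ_q₀, reassoc_of% n.mapR_r₀₂ m h, mapQ_q₀,
      reassoc_of% n.r₀₁_q₀]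
  · rw [Category.assoc, Category.assoc, m.r₀₁_q₁, mapQ_q₁, reassoc_of% n.mapR_r₁₂ m h, mapQ_q₀,
      reassoc_of% n.r₀₁_q₁]

theorem t_mapR : n.t ≫ n.mapR m h = n.mapQ m h ≫ m.t := by
  apply m.isPullback_R.hom_ext
  · rw [Category.assoc, Category.assoc, mapR_r₀₂, m.t_r₀₂, reassoc_of% n.t_r₀₂,
      reassoc_of% n.mapQ_q₁ m h, s_mapQ]
  · rw [Category.assoc, Category.assoc, mapR_r₁₂, m.t_r₁₂, reassoc_of% n.t_r₁₂, Category.comp_id]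

variable {n m} (sq : IsPullback b x a p)

theorem isPullback_q₀ : IsPullback n.q₀ (n.mapQ m sq.w) x m.q₀ := by
  refine IsPullback.of_bot ?_ (n.mapQ_q₀ m sq.w).symm m.isPullback_Q
  rw [mapQ_q₁, ← sq.w]
  exact n.isPullback_Q.flip.paste_horiz sq.flip |>.flip

theorem isPullback_r₀₁ : IsPullback n.r₀₁ (n.mapR m sq.w) (n.mapQ m sq.w) m.r₀₁ := by
  refine IsPullback.of_bot ?_ (n.mapR_r₀₁ m sq.w).symm m.isPullback_dec
  rw [reassoc_of% n.mapR_r₁₂ m sq.w, reassoc_of% n.mapQ_q₁ m sq.w, mapQ_q₁, ← sq.w]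
  have := n.isPullback_dec.flip.paste_horiz sq.flip |>.flip
  simpa only [Category.assoc] using this

end CechNerve

/-- A monadic extension is of descent type: an extension is the coequalizer of the Čech nerve of
its base change. -/
theorem monadicExt.existsUnique_desc {Γ : GaloisStructure C X} {E B A P : C} {p : E ⟶ B}
    (hp : Γ.monadicExt p) {a : A ⟶ B} (ha : Γ.E a) {b : P ⟶ A} {x : P ⟶ E}
    (sq : IsPullback b x a p) (n : CechNerve b) {G : C} {γ : G ⟶ B} (hγ : Γ.E γ) (k : P ⟶ G)
    (hk : k ≫ γ = b ≫ a) (hk' : n.q₀ ≫ k = n.q₁ ≫ k) : ∃! l : A ⟶ G, b ≫ l = k ∧ l ≫ γ = a := by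
  have hx : Γ.E x := Γ.E.of_isPullback sq ha
  have hb : Γ.E b := Γ.E.of_isPullback sq.flip hp.1
  have hq₁ : Γ.E n.q₁ := Γ.E.of_isPullback n.isPullback_Q hb
  have hba : Γ.E (b ≫ a) := Γ.E.comp_mem _ _ hb ha
  have hZ : IsPullback n.q₀ (n.q₁ ≫ x) (b ≫ a) p :=
    (n.isPullback_Q.flip.paste_horiz sq.flip).flip
  have hY : IsPullback n.r₀₁ (n.r₁₂ ≫ n.q₁ ≫ x) (n.q₁ ≫ b ≫ a) p := by
    simpa only [Category.assoc] using (n.isPullback_dec.flip.paste_horiz sq.flip).flip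
  -- The base change of `(q₀, q₁)` along `p` is `(r₀₂, r₁₂)`, split by the diagonal and the extra
  -- degeneracy, with quotient `P`.
  obtain ⟨N, ν', ν, c, hν', hν, -, hc, hqc, hN⟩ := hp.isEffective
    (f := n.q₀) (g := n.q₁) (f' := n.r₀₂) (g' := n.r₁₂) (π := n.q₁) (s := n.s) (t := n.t)
    (Γ.E.comp_mem _ _ hq₁ hba) hba hx
    (by rw [reassoc_of% n.isPullback_Q.w]) rfl hY hZ n.r₀₁_q₀.symm
    (by rw [reassoc_of% n.isPullback_R.w]) n.r₀₁_q₁.symm rfl rfl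
    (by rw [reassoc_of% n.s_q₁]) (by rw [reassoc_of% n.t_r₁₂]) n.isPullback_R.w n.s_q₁ n.t_r₁₂
    n.t_r₀₂
  have hcν : c = ν := by
    have := congrArg (fun m => n.s ≫ m) hqc
    simpa only [reassoc_of% n.s_q₁, reassoc_of% n.s_q₀] using this
  subst hcν
  obtain ⟨l, ⟨hl, hl'⟩, -⟩ := hN a b ha rfl n.isPullback_Q.w
  -- The comparison of the coequalizer `N` with `A` becomes the identity of `P` after base change
  -- along `p`.
  have : IsIso l := hp.isConservative hν' ha hl' hc sq (w' := 𝟙 P) (by rw [hl, Category.id_comp])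
    (Category.id_comp x) inferInstance
  obtain ⟨m, ⟨hm, hm'⟩, hu⟩ := hN γ k hγ hk hk'
  refine ⟨inv l ≫ m, ⟨?_, ?_⟩, ?_⟩
  · rw [← hl, Category.assoc, IsIso.hom_inv_id_assoc, hm]
  · rw [Category.assoc, hm', IsIso.inv_comp_eq, hl']
  · rintro m' ⟨h₁, h₂⟩
    rw [IsIso.eq_inv_comp]
    exact hu _ ⟨by rw [reassoc_of% hl, h₁], by rw [Category.assoc, h₂, hl']⟩

/-! ### Units, transposes, and admissibility for arbitrary pullback squares. -/

/-- The unit `A ⟶ HI(A)` of the adjunction. -/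
def unit (Γ : GaloisStructure C X) (A : C) : A ⟶ Γ.H.obj (Γ.I.obj A) :=
  Γ.adj.unit.app A

theorem unit_map (Γ : GaloisStructure C X) {A B : C} (f : A ⟶ B) :
    Γ.unit A ≫ Γ.H.map (Γ.I.map f) = f ≫ Γ.unit B :=
  (Γ.adj.unit.naturality f).symm

/-- The transpose of a morphism along the adjunction. -/
def transpose (Γ : GaloisStructure C X) {A : C} {Y : X} (a : A ⟶ Γ.H.obj Y) : Γ.I.obj A ⟶ Y :=
  (Γ.adj.homEquiv A Y).symm a

theorem unit_transpose (Γ : GaloisStructure C X) {A : C} {Y : X} (a : A ⟶ Γ.H.obj Y) :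
    Γ.unit A ≫ Γ.H.map (Γ.transpose a) = a :=
  (Γ.adj.homEquiv_unit _ _ _).symm.trans ((Γ.adj.homEquiv A Y).apply_symm_apply a)

theorem I_hom_ext (Γ : GaloisStructure C X) {A : C} {Y : X} {c d : Γ.I.obj A ⟶ Y}
    (h : Γ.unit A ≫ Γ.H.map c = Γ.unit A ≫ Γ.H.map d) : c = d :=
  (Γ.adj.homEquiv A Y).injective
    ((Γ.adj.homEquiv_unit _ _ _).trans (h.trans (Γ.adj.homEquiv_unit _ _ _).symm))

/-- The structure morphism of an object of `(X ↓_F Y)`. -/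
def strF (Γ : GaloisStructure C X) {Y : X} (χ : Γ.F.Over ⊤ Y) : χ.left ⟶ Y :=
  χ.hom

/-- The projection from `H^B(χ)` to `H` of the domain of `χ`. -/
noncomputable def projHB (Γ : GaloisStructure C X) {B : C} (χ : Γ.F.Over ⊤ (Γ.I.obj B)) :
    ((Γ.HB B).obj χ).left ⟶ Γ.H.obj χ.left :=
  Γ.extProj (Γ.adj.unit.app B) ((Γ.overH (Γ.I.obj B)).obj χ)

theorem isPullback_projHB (Γ : GaloisStructure C X) {B : C} (χ : Γ.F.Over ⊤ (Γ.I.obj B)) :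
    IsPullback (Γ.projHB χ) (Γ.str ((Γ.HB B).obj χ)) (Γ.H.map (Γ.strF χ)) (Γ.unit B) :=
  Γ.isPullback_extProj (Γ.adj.unit.app B) ((Γ.overH (Γ.I.obj B)).obj χ)

theorem HB_map_left_projHB (Γ : GaloisStructure C X) {B : C} {χ χ' : Γ.F.Over ⊤ (Γ.I.obj B)}
    (g : χ ⟶ χ') : ((Γ.HB B).map g).left ≫ Γ.projHB χ' = Γ.projHB χ ≫ Γ.H.map g.left :=
  Γ.changeOfBase_map_left_extProj (Γ.adj.unit.app B) ((Γ.overH (Γ.I.obj B)).map g)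

theorem exists_iso_HB (Γ : GaloisStructure C X) {B : C} {χ : Γ.F.Over ⊤ (Γ.I.obj B)}
    {A : C} {a : A ⟶ Γ.H.obj χ.left} {f : A ⟶ B}
    (h : IsPullback a f (Γ.H.map (Γ.strF χ)) (Γ.unit B)) :
    ∃ e : A ≅ ((Γ.HB B).obj χ).left, e.hom ≫ Γ.projHB χ = a ∧
      e.hom ≫ Γ.str ((Γ.HB B).obj χ) = f :=
  ⟨h.isoIsPullback _ _ (Γ.isPullback_projHB χ), by simp, by simp⟩

theorem IsAdmissible.exists_of_over {Γ : GaloisStructure C X} (h : Γ.IsAdmissible) {B : C}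
    {χ χ' : Γ.F.Over ⊤ (Γ.I.obj B)} {A A' : C} {a : A ⟶ Γ.H.obj χ.left} {f : A ⟶ B}
    (sq : IsPullback a f (Γ.H.map (Γ.strF χ)) (Γ.unit B)) {a' : A' ⟶ Γ.H.obj χ'.left} {f' : A' ⟶ B}
    (sq' : IsPullback a' f' (Γ.H.map (Γ.strF χ')) (Γ.unit B)) (u : A ⟶ A') (hu : u ≫ f' = f) :
    ∃ d : χ ⟶ χ', a ≫ Γ.H.map d.left = u ≫ a' := by
  have := (h B).1
  obtain ⟨e, he, hef⟩ := Γ.exists_iso_HB sq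
  obtain ⟨e', he', hef'⟩ := Γ.exists_iso_HB sq'
  let u₁ : (Γ.HB B).obj χ ⟶ (Γ.HB B).obj χ' :=
    MorphismProperty.Over.homMk (e.inv ≫ u ≫ e'.hom)
      (show (e.inv ≫ u ≫ e'.hom) ≫ Γ.str _ = Γ.str _ by
        rw [Category.assoc, Category.assoc, hef', Iso.inv_comp_eq, hef, hu]) trivial
  have hu₁ : u₁.left = e.inv ≫ u ≫ e'.hom := rfl
  obtain ⟨d, hd⟩ := (Γ.HB B).map_surjective u₁
  refine ⟨d, ?_⟩
  rw [← he, Category.assoc, ← HB_map_left_projHB, hd, hu₁]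
  simp [he']

theorem IsAdmissible.eq_of_over {Γ : GaloisStructure C X} (h : Γ.IsAdmissible) {B : C}
    {χ χ' : Γ.F.Over ⊤ (Γ.I.obj B)} {A : C} {a : A ⟶ Γ.H.obj χ.left} {f : A ⟶ B}
    (sq : IsPullback a f (Γ.H.map (Γ.strF χ)) (Γ.unit B)) (c d : χ ⟶ χ')
    (hcd : a ≫ Γ.H.map c.left = a ≫ Γ.H.map d.left) : c = d := by
  have := (h B).2
  obtain ⟨e, he, hef⟩ := Γ.exists_iso_HB sq
  apply (Γ.HB B).map_injective
  ext
  apply (Γ.isPullback_projHB χ').hom_ext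
  · rw [HB_map_left_projHB, HB_map_left_projHB, ← cancel_epi e.hom, reassoc_of% he, hcd,
      reassoc_of% he]
  · rw [left_str, left_str]

theorem IsAdmissible.exists_lift {Γ : GaloisStructure C X} (h : Γ.IsAdmissible) {B : C} {Y Y' : X}
    {φ : Y ⟶ Γ.I.obj B} (hφ : Γ.F φ) {φ' : Y' ⟶ Γ.I.obj B} (hφ' : Γ.F φ') {A A' : C}
    {a : A ⟶ Γ.H.obj Y} {f : A ⟶ B} (sq : IsPullback a f (Γ.H.map φ) (Γ.unit B))
    {a' : A' ⟶ Γ.H.obj Y'} {f' : A' ⟶ B} (sq' : IsPullback a' f' (Γ.H.map φ') (Γ.unit B))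
    (u : A ⟶ A') (hu : u ≫ f' = f) :
    ∃ d : Y ⟶ Y', d ≫ φ' = φ ∧ a ≫ Γ.H.map d = u ≫ a' := by
  obtain ⟨d, hd⟩ := h.exists_of_over (χ := MorphismProperty.Over.mk ⊤ φ hφ)
    (χ' := MorphismProperty.Over.mk ⊤ φ' hφ') sq sq' u hu
  exact ⟨d.left, MorphismProperty.Over.w d, hd⟩

theorem IsAdmissible.hom_ext {Γ : GaloisStructure C X} (h : Γ.IsAdmissible) {B : C} {Y Y' : X}
    {φ : Y ⟶ Γ.I.obj B} (hφ : Γ.F φ) {φ' : Y' ⟶ Γ.I.obj B} (hφ' : Γ.F φ') {A : C}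
    {a : A ⟶ Γ.H.obj Y} {f : A ⟶ B} (sq : IsPullback a f (Γ.H.map φ) (Γ.unit B)) {c d : Y ⟶ Y'}
    (hc : c ≫ φ' = φ) (hd : d ≫ φ' = φ) (hcd : a ≫ Γ.H.map c = a ≫ Γ.H.map d) : c = d :=
  congrArg (fun m => m.left) (h.eq_of_over (χ := MorphismProperty.Over.mk ⊤ φ hφ)
    (χ' := MorphismProperty.Over.mk ⊤ φ' hφ') sq (MorphismProperty.Over.homMk c hc trivial)
    (MorphismProperty.Over.homMk d hd trivial) hcd)

/-- The transpose is the counit at `φ` of the adjunction whose right adjoint is `H^B`; a fully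
faithful right adjoint has invertible counit. Fullness provides the inverse, faithfulness one of the
two identities. -/
theorem IsAdmissible.isIso_transpose {Γ : GaloisStructure C X} (h : Γ.IsAdmissible)
    {A B : C} {Y : X} {φ : Y ⟶ Γ.I.obj B} (hφ : Γ.F φ) {a : A ⟶ Γ.H.obj Y} {f : A ⟶ B}
    (sq : IsPullback a f (Γ.H.map φ) (Γ.unit B)) : IsIso (Γ.transpose a) := by
  have hE : Γ.E f := Γ.E.of_isPullback sq (Γ.map_H _ hφ)
  obtain ⟨A', b, f', sq'⟩ := Γ.exists_isPullback (Γ.map_H _ (Γ.map_I _ hE)) (Γ.unit B)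
  obtain ⟨d, hdφ, hd⟩ := h.exists_lift hφ (Γ.map_I _ hE) sq sq'
    (sq'.lift (Γ.unit A) f (Γ.unit_map f)) (sq'.lift_snd _ _ _)
  rw [sq'.lift_fst] at hd
  have hcφ : Γ.transpose a ≫ φ = Γ.I.map f := by
    apply Γ.I_hom_ext
    rw [Γ.H.map_comp, reassoc_of% Γ.unit_transpose, sq.w, unit_map]
  refine ⟨d, ?_, h.hom_ext hφ hφ sq (by rw [Category.assoc, hcφ, hdφ]) (Category.id_comp _) ?_⟩
  · apply Γ.I_hom_ext
    rw [Γ.H.map_comp, reassoc_of% Γ.unit_transpose, hd]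
    simp
  · rw [Γ.H.map_comp, reassoc_of% hd, unit_transpose]
    simp

theorem trivialExt.isPullback {Γ : GaloisStructure C X} {A B : C} {f : A ⟶ B}
    (h : Γ.trivialExt f) : IsPullback (Γ.unit A) f (Γ.H.map (Γ.I.map f)) (Γ.unit B) :=
  h.2

theorem trivialExt.of_isPullback_unit {Γ : GaloisStructure C X} {A B : C} {f : A ⟶ B}
    (hf : Γ.E f) (h : IsPullback (Γ.unit A) f (Γ.H.map (Γ.I.map f)) (Γ.unit B)) :
    Γ.trivialExt f :=
  ⟨hf, h⟩

/-! ### The trivialization of an extension and its functoriality. -/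

section

variable (Γ : GaloisStructure C X)

/-- For an extension `x : Y ⟶ S`, the pullback of `HI(x)` along the unit `S ⟶ HI(S)`. -/
noncomputable def trivObj {Y S : C} (x : Y ⟶ S) (hx : Γ.E x) : C :=
  (Γ.exists_isPullback (Γ.map_H _ (Γ.map_I x hx)) (Γ.unit S)).choose

/-- The projection from `trivObj` to `HI(Y)`. -/
noncomputable def trivProj {Y S : C} (x : Y ⟶ S) (hx : Γ.E x) :
    Γ.trivObj x hx ⟶ Γ.H.obj (Γ.I.obj Y) :=
  (Γ.exists_isPullback (Γ.map_H _ (Γ.map_I x hx)) (Γ.unit S)).choose_spec.choose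

/-- The projection from `trivObj` to the base `S`. -/
noncomputable def trivStr {Y S : C} (x : Y ⟶ S) (hx : Γ.E x) : Γ.trivObj x hx ⟶ S :=
  (Γ.exists_isPullback (Γ.map_H _ (Γ.map_I x hx)) (Γ.unit S)).choose_spec.choose_spec.choose

theorem isPullback_triv {Y S : C} (x : Y ⟶ S) (hx : Γ.E x) :
    IsPullback (Γ.trivProj x hx) (Γ.trivStr x hx) (Γ.H.map (Γ.I.map x)) (Γ.unit S) :=
  (Γ.exists_isPullback (Γ.map_H _ (Γ.map_I x hx)) (Γ.unit S)).choose_spec.choose_spec.choose_spec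

theorem E_trivStr {Y S : C} (x : Y ⟶ S) (hx : Γ.E x) : Γ.E (Γ.trivStr x hx) :=
  Γ.E.of_isPullback (Γ.isPullback_triv x hx) (Γ.map_H _ (Γ.map_I x hx))

/-- The comparison morphism from an extension to its trivialization. -/
noncomputable def trivUnit {Y S : C} (x : Y ⟶ S) (hx : Γ.E x) : Y ⟶ Γ.trivObj x hx :=
  (Γ.isPullback_triv x hx).lift (Γ.unit Y) x (Γ.unit_map x)

theorem trivUnit_proj {Y S : C} (x : Y ⟶ S) (hx : Γ.E x) :
    Γ.trivUnit x hx ≫ Γ.trivProj x hx = Γ.unit Y :=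
  (Γ.isPullback_triv x hx).lift_fst _ _ _

theorem trivUnit_str {Y S : C} (x : Y ⟶ S) (hx : Γ.E x) :
    Γ.trivUnit x hx ≫ Γ.trivStr x hx = x :=
  (Γ.isPullback_triv x hx).lift_snd _ _ _

/-- Functoriality of `trivObj` on commutative squares. -/
noncomputable def trivMap {Y S Y' S' : C} {x : Y ⟶ S} (hx : Γ.E x) {x' : Y' ⟶ S'} (hx' : Γ.E x')
    (u : Y ⟶ Y') (v : S ⟶ S') (h : u ≫ x' = x ≫ v) : Γ.trivObj x hx ⟶ Γ.trivObj x' hx' :=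
  (Γ.isPullback_triv x' hx').lift (Γ.trivProj x hx ≫ Γ.H.map (Γ.I.map u)) (Γ.trivStr x hx ≫ v) (by
    rw [Category.assoc, Category.assoc, ← Γ.H.map_comp, ← Γ.I.map_comp, h,
      Γ.I.map_comp, Γ.H.map_comp, reassoc_of% (Γ.isPullback_triv x hx).w, unit_map])

variable {Y S Y' S' Y'' S'' : C} {x : Y ⟶ S} (hx : Γ.E x) {x' : Y' ⟶ S'} (hx' : Γ.E x')
  {x'' : Y'' ⟶ S''} (hx'' : Γ.E x'')

theorem trivMap_proj (u : Y ⟶ Y') (v : S ⟶ S') (h : u ≫ x' = x ≫ v) :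
    Γ.trivMap hx hx' u v h ≫ Γ.trivProj x' hx' = Γ.trivProj x hx ≫ Γ.H.map (Γ.I.map u) :=
  (Γ.isPullback_triv x' hx').lift_fst _ _ _

theorem trivMap_str (u : Y ⟶ Y') (v : S ⟶ S') (h : u ≫ x' = x ≫ v) :
    Γ.trivMap hx hx' u v h ≫ Γ.trivStr x' hx' = Γ.trivStr x hx ≫ v :=
  (Γ.isPullback_triv x' hx').lift_snd _ _ _

theorem trivMap_id (h : 𝟙 Y ≫ x = x ≫ 𝟙 S) : Γ.trivMap hx hx (𝟙 Y) (𝟙 S) h = 𝟙 _ := by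
  apply (Γ.isPullback_triv x hx).hom_ext
  · rw [trivMap_proj]; simp
  · rw [trivMap_str]; simp

theorem trivMap_comp (u : Y ⟶ Y') (v : S ⟶ S') (h : u ≫ x' = x ≫ v) (u' : Y' ⟶ Y'')
    (v' : S' ⟶ S'') (h' : u' ≫ x'' = x' ≫ v') :
    Γ.trivMap hx hx' u v h ≫ Γ.trivMap hx' hx'' u' v' h' =
      Γ.trivMap hx hx'' (u ≫ u') (v ≫ v')
        (by rw [Category.assoc, h', reassoc_of% h]) := by
  apply (Γ.isPullback_triv x'' hx'').hom_ext
  · rw [Category.assoc, trivMap_proj, trivMap_proj, reassoc_of% Γ.trivMap_proj hx hx' u v h]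
    simp
  · rw [Category.assoc, trivMap_str, trivMap_str, reassoc_of% Γ.trivMap_str hx hx' u v h]

theorem trivMap_congr {u u' : Y ⟶ Y'} {v v' : S ⟶ S'} (h : u ≫ x' = x ≫ v) (hu : u = u')
    (hv : v = v') :
    Γ.trivMap hx hx' u v h = Γ.trivMap hx hx' u' v' (by rw [← hu, ← hv, h]) := by
  subst hu hv
  rfl

theorem trivUnit_trivMap (u : Y ⟶ Y') (v : S ⟶ S') (h : u ≫ x' = x ≫ v) :
    Γ.trivUnit x hx ≫ Γ.trivMap hx hx' u v h = u ≫ Γ.trivUnit x' hx' := by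
  apply (Γ.isPullback_triv x' hx').hom_ext
  · rw [Category.assoc, Category.assoc, trivMap_proj, trivUnit_proj,
      reassoc_of% Γ.trivUnit_proj x hx, unit_map]
  · rw [Category.assoc, Category.assoc, trivMap_str, trivUnit_str,
      reassoc_of% Γ.trivUnit_str x hx, h]

theorem trivialExt_iff_isIso_trivUnit : Γ.trivialExt x ↔ IsIso (Γ.trivUnit x hx) := by
  constructor
  · intro h'
    have h := h'.isPullback
    have : Γ.trivUnit x hx = (h.isoIsPullback _ _ (Γ.isPullback_triv x hx)).hom := by
      apply (Γ.isPullback_triv x hx).hom_ext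
      · rw [trivUnit_proj, IsPullback.isoIsPullback_hom_fst]
      · rw [trivUnit_str, IsPullback.isoIsPullback_hom_snd]
    rw [this]
    infer_instance
  · intro h
    refine .of_isPullback_unit hx (IsPullback.of_iso' (Γ.isPullback_triv x hx) (asIso (Γ.trivUnit x hx)) (Iso.refl _)
      (Iso.refl _) (Iso.refl _) ?_ ?_ (by simp) (by simp))
    · simp [trivUnit_proj]
    · simp [trivUnit_str]

end

/-! ### Trivialization of split extensions. -/

variable {Γ : GaloisStructure C X}

/-- The trivialization of a pullback of a split extension along an extension is the pullback of
its trivialization. -/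
theorem PreservesSplitPullbacks.isPullback_trivMap (hI : Γ.PreservesSplitPullbacks)
    {Y S Y' S' : C} {x : Y ⟶ S} (hx : Γ.E x) {x' : Y' ⟶ S'} (hx' : Γ.E x') {u : Y ⟶ Y'}
    {v : S ⟶ S'} (sq : IsPullback u x x' v) (hs : IsSplitEpi x') (hv : Γ.E v) :
    IsPullback (Γ.trivMap hx hx' u v sq.w) (Γ.trivStr x hx) (Γ.trivStr x' hx') v := by
  have : PreservesLimitsOfSize.{0, 0} Γ.H := Γ.adj.rightAdjoint_preservesLimits
  have h := (hI u x x' v sq hs hx' hv).map Γ.H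
  refine IsPullback.flip (IsPullback.of_bot ?_ (Γ.trivMap_str hx hx' u v sq.w).symm
    (Γ.isPullback_triv x' hx').flip)
  rw [trivMap_proj, ← unit_map]
  exact (Γ.isPullback_triv x hx).flip.paste_vert h.flip

/-- The transpose of `a` is an isomorphism from `I.map f` to `φ` over `I(B)`, so the given square is
the naturality square of the unit. -/
theorem trivialExt_of_isPullback (hadm : Γ.split.IsAdmissible) {A B : C} {Y : X}
    {φ : Y ⟶ Γ.I.obj B} (hφ : Γ.F φ) (hs : IsSplitEpi φ) {a : A ⟶ Γ.H.obj Y} {f : A ⟶ B}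
    (sq : IsPullback a f (Γ.H.map φ) (Γ.unit B)) : Γ.trivialExt f := by
  have : IsIso (Γ.transpose a) := hadm.isIso_transpose ⟨hφ, hs⟩ sq
  have hc : Γ.unit A ≫ Γ.H.map (Γ.transpose a) = a := Γ.unit_transpose a
  refine .of_isPullback_unit (Γ.E.of_isPullback sq (Γ.map_H _ hφ)) (IsPullback.of_iso' sq (Iso.refl _)
    (asIso (Γ.H.map (Γ.transpose a))) (Iso.refl _) (Iso.refl _) ?_ (by simp) ?_
    (by simp))
  · simpa using hc.symm
  · simp only [asIso_hom, Iso.refl_hom, Category.comp_id, ← CategoryTheory.Functor.map_comp]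
    congr 1
    apply Γ.I_hom_ext
    rw [Γ.H.map_comp, reassoc_of% hc, sq.w, unit_map]

theorem trivialExt_trivStr (hadm : Γ.split.IsAdmissible) {Y S : C} {x : Y ⟶ S} (hx : Γ.E x)
    (hs : IsSplitEpi x) : Γ.trivialExt (Γ.trivStr x hx) :=
  trivialExt_of_isPullback hadm (Γ.map_I x hx) inferInstance (Γ.isPullback_triv x hx)

theorem isIso_I_map_trivUnit (hadm : Γ.split.IsAdmissible) {Y S : C} {x : Y ⟶ S} (hx : Γ.E x)
    (hs : IsSplitEpi x) : IsIso (Γ.I.map (Γ.trivUnit x hx)) := by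
  have : IsIso (Γ.transpose (Γ.trivProj x hx)) :=
    hadm.isIso_transpose ⟨Γ.map_I x hx, (inferInstance : IsSplitEpi (Γ.I.map x))⟩
      (Γ.isPullback_triv x hx)
  have h : Γ.I.map (Γ.trivUnit x hx) ≫
      Γ.transpose (Γ.trivProj x hx) = 𝟙 _ := by
    apply Γ.I_hom_ext
    rw [Γ.H.map_comp, reassoc_of% Γ.unit_map, unit_transpose, trivUnit_proj]
    simp
  rw [← IsIso.inv_eq_of_inv_hom_id h]
  infer_instance

/-- A morphism from the trivialization of a split extension to a trivial extension is determined
by its restriction to the split extension. -/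
theorem trivObj_hom_ext (hadm : Γ.split.IsAdmissible) {Y S R : C} {x : Y ⟶ S} (hx : Γ.E x)
    (hs : IsSplitEpi x) {r : R ⟶ S} (hr : Γ.trivialExt r) {k l : Γ.trivObj x hx ⟶ R}
    (hkl : k ≫ r = l ≫ r) (h : Γ.trivUnit x hx ≫ k = Γ.trivUnit x hx ≫ l) : k = l := by
  have := isIso_I_map_trivUnit hadm hx hs
  apply hr.isPullback.hom_ext _ hkl
  have : Γ.I.map k = Γ.I.map l := by
    rw [← cancel_epi (Γ.I.map (Γ.trivUnit x hx)), ← CategoryTheory.Functor.map_comp, h, CategoryTheory.Functor.map_comp]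
  rw [← unit_map, ← unit_map, this]

theorem trivialExt.of_isPullback_of_isSplitEpi (hadm : Γ.split.IsAdmissible) {A B A' B' : C}
    {f : A ⟶ B} (hf : Γ.trivialExt f) (hs : IsSplitEpi f) {a : A' ⟶ A} {f' : A' ⟶ B'} {k : B' ⟶ B}
    (sq : IsPullback a f' f k) : Γ.trivialExt f' := by
  have : PreservesLimitsOfSize.{0, 0} Γ.H := Γ.adj.rightAdjoint_preservesLimits
  have hF := Γ.map_I f hf.1
  have : HasPullback (Γ.I.map f) (Γ.I.map k) :=
    MorphismProperty.HasPullbacks.hasPullback (Γ.I.map k) hF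
  have hP := IsPullback.of_hasPullback (Γ.I.map f) (Γ.I.map k)
  have h₁ : IsPullback (a ≫ Γ.unit A) f' (Γ.H.map (Γ.I.map f))
      (Γ.unit B' ≫ Γ.H.map (Γ.I.map k)) := by
    rw [unit_map]
    exact (sq.flip.paste_vert hf.isPullback.flip).flip
  -- By naturality of the unit, `f'` is the pullback of `HI(f)` along `unit B' ≫ HI(k)`. Cancelling
  -- the `H`-image of the pullback of `I(f)` along `I(k)` exhibits `f'` as a pullback along `unit
  -- B'` of `H` of a split epimorphism in `F`.
  have h₂ := IsPullback.of_right' h₁ (hP.map Γ.H)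
  exact trivialExt_of_isPullback hadm (Γ.F.of_isPullback hP hF)
    ((splitEpis_isStableUnderBaseChange X).of_isPullback hP (inferInstance : IsSplitEpi (Γ.I.map f)))
    h₂

/-- A split extension is trivial as soon as its pullback along some conservative extension is. -/
theorem PreservesSplitPullbacks.trivialExt_of_isConservative (hI : Γ.PreservesSplitPullbacks)
    {Y S Y' S' : C} {x : Y ⟶ S} {x' : Y' ⟶ S'} (hx' : Γ.E x') {u : Y ⟶ Y'}
    {v : S ⟶ S'} (sq : IsPullback u x x' v) (hs : IsSplitEpi x') (hv : Γ.E v)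
    (hv' : Γ.IsConservative v) (h : Γ.trivialExt x) : Γ.trivialExt x' := by
  rw [Γ.trivialExt_iff_isIso_trivUnit hx']
  rw [Γ.trivialExt_iff_isIso_trivUnit h.1] at h
  exact hv' hx' (Γ.E_trivStr x' hx') (Γ.trivUnit_str x' hx') sq
    (hI.isPullback_trivMap _ hx' sq hs hv) (Γ.trivUnit_trivMap _ hx' u v sq.w)
    (Γ.trivUnit_str x _) h

/-! ### Normal extensions and their kernel pairs. -/

theorem isSplitEpi_of_isPullback_self {A B P : C} {f : A ⟶ B} {a b : P ⟶ A}
    (sq : IsPullback a b f f) : IsSplitEpi b :=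
  ⟨⟨sq.lift (𝟙 A) (𝟙 A) rfl, sq.lift_snd _ _ _⟩⟩

theorem normalExt.trivialExt_of_isPullback (hadm : Γ.split.IsAdmissible) {A B P : C} {f : A ⟶ B}
    (hf : Γ.normalExt f) {a b : P ⟶ A} (sq : IsPullback a b f f) : Γ.trivialExt b := by
  obtain ⟨hE, ht⟩ := hf.2
  have sq' := Γ.isPullback_extProj f (MorphismProperty.Over.mk ⊤ f hE : Γ.Ext B)
  exact trivialExt.of_isPullback_of_isSplitEpi (f := Γ.str _) hadm ht
    (isSplitEpi_of_isPullback_self sq')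
    (IsPullback.of_right' (h₂₁ := 𝟙 A) (h₂₂ := f) (by rwa [Category.id_comp]) sq')

theorem normalExt.of_isPullback_self {A B : C} {f : A ⟶ B} (hf : Γ.monadicExt f)
    (h : ∀ ⦃P : C⦄ ⦃a b : P ⟶ A⦄, IsPullback a b f f → Γ.trivialExt b) : Γ.normalExt f :=
  ⟨hf, hf.1, h (Γ.isPullback_extProj f (MorphismProperty.Over.mk ⊤ f hf.1 : Γ.Ext B))⟩

/-- If a normal extension `g` admits a morphism from `p` over the base, then `p^*(g)` is a split
trivial extension. -/
theorem normalExt.isSplitEpi_and_trivialExt (hadm : Γ.split.IsAdmissible) {G B E R : C} {g : G ⟶ B}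
    (hg : Γ.normalExt g) {p : E ⟶ B} {k : E ⟶ G} (hk : k ≫ g = p) {r : R ⟶ G} {ρ : R ⟶ E}
    (sq : IsPullback r ρ g p) : IsSplitEpi ρ ∧ Γ.trivialExt ρ := by
  subst hk
  obtain ⟨M, a, b, hM⟩ := Γ.exists_isPullback hg.1.1 g
  -- As `p = k ≫ g`, the map `ρ` is the pullback along `k` of the kernel pair projection `b` of `g`.
  have h := IsPullback.of_right' sq hM
  have hb := isSplitEpi_of_isPullback_self hM
  exact ⟨(splitEpis_isStableUnderBaseChange C).of_isPullback h hb,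
    (hg.trivialExt_of_isPullback hadm hM).of_isPullback_of_isSplitEpi hadm hb h⟩

/-- For a trivial extension `x`, the inverse of the comparison with its trivialization. -/
noncomputable def trivInv {Y S : C} {x : Y ⟶ S} (h : Γ.trivialExt x) : Γ.trivObj x h.1 ⟶ Y :=
  have := (Γ.trivialExt_iff_isIso_trivUnit h.1).1 h
  inv (Γ.trivUnit x h.1)

theorem trivUnit_trivInv {Y S : C} {x : Y ⟶ S} (h : Γ.trivialExt x) :
    Γ.trivUnit x h.1 ≫ trivInv h = 𝟙 Y :=
  have := (Γ.trivialExt_iff_isIso_trivUnit h.1).1 h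
  IsIso.hom_inv_id (Γ.trivUnit x h.1)

theorem trivMap_trivInv {Y S Y' S' : C} {x : Y ⟶ S} (h : Γ.trivialExt x) {x' : Y' ⟶ S'}
    (h' : Γ.trivialExt x') (u : Y ⟶ Y') (v : S ⟶ S') (w : u ≫ x' = x ≫ v) :
    Γ.trivMap h.1 h'.1 u v w ≫ trivInv h' = trivInv h ≫ u := by
  have := (Γ.trivialExt_iff_isIso_trivUnit h.1).1 h
  rw [← cancel_epi (Γ.trivUnit x h.1), reassoc_of% Γ.trivUnit_trivMap, trivUnit_trivInv,
    reassoc_of% trivUnit_trivInv h, Category.comp_id]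

theorem trivInv_comp {Y S : C} {x : Y ⟶ S} (h : Γ.trivialExt x) :
    trivInv h ≫ x = Γ.trivStr x h.1 := by
  have := (Γ.trivialExt_iff_isIso_trivUnit h.1).1 h
  rw [← cancel_epi (Γ.trivUnit x h.1), reassoc_of% trivUnit_trivInv h, trivUnit_str]

theorem CechNerve.E_mapQ {P A E B : C} {b : P ⟶ A} {p : E ⟶ B} {x : P ⟶ E} {a : A ⟶ B}
    (n : CechNerve b) (m : CechNerve p) (sq : IsPullback b x a p) (hx : Γ.E x) :
    Γ.E (n.mapQ m sq.w) :=
  Γ.E.of_isPullback (CechNerve.isPullback_q₀ sq) hx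

/-! ### Construction of the normal reflection by descent. -/

section

variable {A B E P : C} {f : A ⟶ B} {p : E ⟶ B} {b : P ⟶ A} {x : P ⟶ E}

/-- The trivialization of the base change `x = p^*(f)` of an extension `f` descends along `p`,
when `x` is a split epimorphism. -/
theorem exists_descent_trivObj (hI : Γ.PreservesSplitPullbacks) (hp : Γ.monadicExt p)
    (sq : IsPullback b x f p) (hx : Γ.E x) (hs : IsSplitEpi x) (n : CechNerve b)
    (m : CechNerve p) :
    ∃ (N : C) (g : N ⟶ B) (ν : Γ.trivObj x hx ⟶ N), Γ.E g ∧
      IsPullback ν (Γ.trivStr x hx) g p ∧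
      Γ.trivMap (n.E_mapQ m sq hx) hx n.q₀ m.q₀ (n.mapQ_q₀ m sq.w).symm ≫ ν =
        Γ.trivMap (n.E_mapQ m sq hx) hx n.q₁ m.q₁ (n.mapQ_q₁ m sq.w).symm ≫ ν ∧
      ∀ ⦃G : C⦄ (γ : G ⟶ B) (k : Γ.trivObj x hx ⟶ G), Γ.E γ → k ≫ γ = Γ.trivStr x hx ≫ p →
        Γ.trivMap (n.E_mapQ m sq hx) hx n.q₀ m.q₀ (n.mapQ_q₀ m sq.w).symm ≫ k =
          Γ.trivMap (n.E_mapQ m sq hx) hx n.q₁ m.q₁ (n.mapQ_q₁ m sq.w).symm ≫ k →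
        ∃! l : N ⟶ G, ν ≫ l = k ∧ l ≫ γ = g := by
  have hpE := hp.1
  have hm₀ : Γ.E m.q₀ := Γ.E.of_isPullback m.isPullback_Q.flip hpE
  have hm₁ : Γ.E m.q₁ := Γ.E.of_isPullback m.isPullback_Q hpE
  have hmd : Γ.E m.r₀₁ := Γ.E.of_isPullback m.isPullback_dec.flip hpE
  have hQ := n.E_mapQ m sq hx
  have sqQ := CechNerve.isPullback_q₀ (n := n) (m := m) sq
  have sqR := CechNerve.isPullback_r₀₁ (n := n) (m := m) sq
  have hsQ : IsSplitEpi (n.mapQ m sq.w) :=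
    (splitEpis_isStableUnderBaseChange C).of_isPullback sqQ hs
  have hR : Γ.E (n.mapR m sq.w) := Γ.E.of_isPullback sqR hQ
  -- These two squares are where preservation of pullbacks by `I` enters: the trivialized nerve is
  -- still cartesian over the nerve of `p`, hence is a descent datum.
  have tQ := hI.isPullback_trivMap hQ hx sqQ hs hm₀
  have tR := hI.isPullback_trivMap hR hQ sqR hsQ hmd
  have hZ := (tQ.flip.paste_horiz m.isPullback_Q.flip).flip
  have hY := (tR.flip.paste_horiz m.isPullback_dec.flip).flip
  have e₀₀ := Γ.trivMap_comp hR hQ hx n.r₀₁ m.r₀₁ sqR.w n.q₀ m.q₀ sqQ.w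
  have e₀₁ := Γ.trivMap_comp hR hQ hx n.r₀₁ m.r₀₁ sqR.w n.q₁ m.q₁ (n.mapQ_q₁ m sq.w).symm
  have e₂₀ := Γ.trivMap_comp hR hQ hx n.r₀₂ m.r₀₂ (n.mapR_r₀₂ m sq.w).symm n.q₀ m.q₀ sqQ.w
  have e₁₀ := Γ.trivMap_comp hR hQ hx n.r₁₂ m.r₁₂ (n.mapR_r₁₂ m sq.w).symm n.q₀ m.q₀ sqQ.w
  have e₂₁ := Γ.trivMap_comp hR hQ hx n.r₀₂ m.r₀₂ (n.mapR_r₀₂ m sq.w).symm n.q₁ m.q₁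
    (n.mapQ_q₁ m sq.w).symm
  have e₁₁ := Γ.trivMap_comp hR hQ hx n.r₁₂ m.r₁₂ (n.mapR_r₁₂ m sq.w).symm n.q₁ m.q₁
    (n.mapQ_q₁ m sq.w).symm
  have es₀ := Γ.trivMap_comp hx hQ hx n.s m.s (n.s_mapQ m sq.w) n.q₀ m.q₀ sqQ.w
  have es₁ := Γ.trivMap_comp hx hQ hx n.s m.s (n.s_mapQ m sq.w) n.q₁ m.q₁
    (n.mapQ_q₁ m sq.w).symm
  rw [Γ.trivMap_congr hx hx _ n.s_q₀ m.s_q₀, trivMap_id] at es₀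
  rw [Γ.trivMap_congr hx hx _ n.s_q₁ m.s_q₁, trivMap_id] at es₁
  have et₁ := Γ.trivMap_comp hQ hR hQ n.t m.t (n.t_mapR m sq.w) n.r₁₂ m.r₁₂
    (n.mapR_r₁₂ m sq.w).symm
  rw [Γ.trivMap_congr hQ hQ _ n.t_r₁₂ m.t_r₁₂, trivMap_id] at et₁
  have et₀ := Γ.trivMap_comp hQ hR hQ n.t m.t (n.t_mapR m sq.w) n.r₀₂ m.r₀₂
    (n.mapR_r₀₂ m sq.w).symm
  have eqs := Γ.trivMap_comp hQ hx hQ n.q₁ m.q₁ (n.mapQ_q₁ m sq.w).symm n.s m.s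
    (n.s_mapQ m sq.w)
  obtain ⟨N, g, ν, c, hg, hν, hν', hc, hqc, hN⟩ := hp.isEffective
    (f := Γ.trivMap hQ hx n.q₀ m.q₀ sqQ.w)
    (g := Γ.trivMap hQ hx n.q₁ m.q₁ (n.mapQ_q₁ m sq.w).symm)
    (f' := Γ.trivMap hR hQ n.r₀₂ m.r₀₂ (n.mapR_r₀₂ m sq.w).symm)
    (g' := Γ.trivMap hR hQ n.r₁₂ m.r₁₂ (n.mapR_r₁₂ m sq.w).symm)
    (π := Γ.trivMap hQ hx n.q₁ m.q₁ (n.mapQ_q₁ m sq.w).symm)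
    (s := Γ.trivMap hx hQ n.s m.s (n.s_mapQ m sq.w))
    (t := Γ.trivMap hQ hR n.t m.t (n.t_mapR m sq.w))
    (Γ.E.comp_mem _ _ (Γ.E_trivStr _ hQ) (Γ.E.comp_mem _ _ hm₁ hpE))
    (Γ.E.comp_mem _ _ (Γ.E_trivStr x hx) hpE) (Γ.E_trivStr x hx)
    (by rw [reassoc_of% Γ.trivMap_str hQ hx, m.isPullback_Q.w])
    (by rw [reassoc_of% Γ.trivMap_str hQ hx])
    hY hZ
    (by rw [e₂₀, e₀₀]; exact Γ.trivMap_congr _ _ _ n.r₀₁_q₀.symm m.r₀₁_q₀.symm)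
    (by rw [reassoc_of% Γ.trivMap_str hR hQ, m.isPullback_R.w])
    (by rw [e₁₀, e₀₁]; exact Γ.trivMap_congr _ _ _ n.r₀₁_q₁.symm m.r₀₁_q₁.symm)
    (by rw [reassoc_of% Γ.trivMap_str hR hQ])
    (Γ.trivMap_str hQ hx _ _ _)
    (by rw [reassoc_of% Γ.trivMap_str hx hQ, m.s_q₁, Category.comp_id])
    (by rw [reassoc_of% Γ.trivMap_str hQ hR, reassoc_of% m.t_r₁₂])
    (by rw [e₂₁, e₁₁]; exact Γ.trivMap_congr _ _ _ n.isPullback_R.w m.isPullback_R.w)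
    es₁ et₁ (by rw [et₀, eqs]; exact Γ.trivMap_congr _ _ _ n.t_r₀₂ m.t_r₀₂)
  have hcν : c = ν := by
    have := congrArg (fun l => Γ.trivMap hx hQ n.s m.s (n.s_mapQ m sq.w) ≫ l) hqc
    simpa only [reassoc_of% es₁, reassoc_of% es₀] using this
  subst hcν
  exact ⟨N, g, c, hg, hc, hν', hN⟩

/-- An extension `g` whose base change along a monadic extension `p` is a trivial split extension
is normal. -/
theorem normalExt.of_isPullback_trivialExt (hI : Γ.PreservesSplitPullbacks)
    (hadm : Γ.split.IsAdmissible) (hp : Γ.monadicExt p) {N T : C} {g : N ⟶ B} (hg : Γ.E g)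
    {ν : T ⟶ N} {τ : T ⟶ E} (sq : IsPullback ν τ g p) (hs : IsSplitEpi τ) (hτ : Γ.trivialExt τ) :
    Γ.normalExt g := by
  -- A section of `τ` makes `p` factor through `g`, so `g` is monadic by cancellation.
  have hq : (section_ τ ≫ ν) ≫ g = p := by
    rw [Category.assoc, sq.w, IsSplitEpi.id_assoc]
  have hm : Γ.monadicExt ((section_ τ ≫ ν) ≫ g) := by rwa [hq]
  refine normalExt.of_isPullback_self (hm.of_comp hg) ?_
  intro M d₀ d₁ hM
  obtain ⟨W, u, w, hW⟩ := Γ.exists_isPullback (Γ.E.of_isPullback hM hg) ν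
  -- The pullback `w` of `d₁` along `ν` is also the pullback of `τ` along itself, hence trivial.
  -- Triviality passes down to `d₁` because `ν`, a pullback of `p`, is conservative.
  have h₁ : IsPullback (u ≫ d₀) w g (τ ≫ p) := by
    rw [← sq.w]
    exact (hW.flip.paste_vert hM.flip).flip
  exact hI.trivialExt_of_isConservative (Γ.E.of_isPullback hM hg) hW
    (isSplitEpi_of_isPullback_self hM) (Γ.E.of_isPullback sq.flip hp.1)
    (hp.isConservative.of_isPullback hg sq)
    (hτ.of_isPullback_of_isSplitEpi hadm hs (IsPullback.of_right' h₁ sq))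

/-- A monadic extension `f` has a reflection among the normal extensions of its codomain as soon
as some monadic extension `p` factors through `f`. -/
theorem exists_normal_reflection (hI : Γ.PreservesSplitPullbacks) (hadm : Γ.split.IsAdmissible)
    (hf : Γ.monadicExt f) (hp : Γ.monadicExt p) (e : E ⟶ A) (he : e ≫ f = p) :
    ∃ (N : C) (g : N ⟶ B) (u : A ⟶ N), Γ.normalExt g ∧ u ≫ g = f ∧
      ∀ ⦃G : C⦄ (γ : G ⟶ B) (h : A ⟶ G), Γ.normalExt γ → h ≫ γ = f →
        ∃! l : N ⟶ G, u ≫ l = h ∧ l ≫ γ = g := by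
  obtain ⟨P, b, x, sq⟩ := Γ.exists_isPullback hf.1 p
  have hx : Γ.E x := Γ.E.of_isPullback sq hf.1
  have hb : Γ.E b := Γ.E.of_isPullback sq.flip hp.1
  have hs : IsSplitEpi x := ⟨⟨sq.lift e (𝟙 E) (by rw [he, Category.id_comp]), sq.lift_snd _ _ _⟩⟩
  obtain ⟨n⟩ := CechNerve.nonempty Γ hb
  obtain ⟨m⟩ := CechNerve.nonempty Γ hp.1
  have hQ := n.E_mapQ m sq hx
  obtain ⟨N, g, ν, hg, hN, hν, univ⟩ := exists_descent_trivObj hI hp sq hx hs n m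
  have hsT : IsSplitEpi (Γ.trivStr x hx) := ⟨⟨section_ x ≫ Γ.trivUnit x hx, by
    rw [Category.assoc, trivUnit_str, IsSplitEpi.id]⟩⟩
  have hgN : Γ.normalExt g := normalExt.of_isPullback_trivialExt hI hadm hp hg hN hsT
    (trivialExt_trivStr hadm hx hs)
  obtain ⟨u, ⟨hu, hu'⟩, -⟩ := hp.existsUnique_desc hf.1 sq n hg (Γ.trivUnit x hx ≫ ν)
    (by rw [Category.assoc, hN.w, reassoc_of% Γ.trivUnit_str, sq.w])
    (by rw [← reassoc_of% Γ.trivUnit_trivMap hQ hx n.q₀ m.q₀ (n.mapQ_q₀ m sq.w).symm, hν,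
      reassoc_of% Γ.trivUnit_trivMap hQ hx n.q₁ m.q₁ (n.mapQ_q₁ m sq.w).symm])
  refine ⟨N, g, u, hgN, hu', ?_⟩
  intro G γ h hγ hh
  obtain ⟨R, r, ρ, sqR⟩ := Γ.exists_isPullback hγ.1.1 p
  obtain ⟨hsρ, htρ⟩ := hγ.isSplitEpi_and_trivialExt hadm (k := e ≫ h)
    (by rw [Category.assoc, hh, he]) sqR
  obtain ⟨o⟩ := CechNerve.nonempty Γ (Γ.E.of_isPullback sqR.flip hp.1)
  let h' : P ⟶ R := sqR.lift (b ≫ h) x (by rw [Category.assoc, hh, sq.w])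
  have hh' : h' ≫ r = b ≫ h := sqR.lift_fst _ _ _
  have hh'' : h' ≫ ρ = x := sqR.lift_snd _ _ _
  have hoQ : Γ.trivialExt (o.mapQ m sqR.w) :=
    htρ.of_isPullback_of_isSplitEpi hadm hsρ (CechNerve.isPullback_q₀ sqR)
  have hQQ : n.mapQ o hh'.symm ≫ o.mapQ m sqR.w = n.mapQ m sq.w ≫ 𝟙 m.Q := by
    rw [Category.comp_id]
    apply m.isPullback_Q.hom_ext
    · rw [Category.assoc, CechNerve.mapQ_q₀, reassoc_of% n.mapQ_q₀ o, hh'', CechNerve.mapQ_q₀]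
    · rw [Category.assoc, CechNerve.mapQ_q₁, reassoc_of% n.mapQ_q₁ o, hh'', CechNerve.mapQ_q₁]
  have hw : h' ≫ ρ = x ≫ 𝟙 E := by rw [hh'', Category.comp_id]
  -- The extension of `h'` along `trivUnit x hx`, which exists because `ρ` agrees with its
  -- trivialization. The map `y'` does the same over `m.Q` and witnesses that `y` respects the
  -- descent data.
  let y : Γ.trivObj x hx ⟶ R := Γ.trivMap hx htρ.1 h' (𝟙 E) hw ≫ trivInv htρ
  let y' : Γ.trivObj _ hQ ⟶ o.Q :=
    Γ.trivMap hQ hoQ.1 (n.mapQ o hh'.symm) (𝟙 m.Q) hQQ ≫ trivInv hoQ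
  have hy : Γ.trivUnit x hx ≫ y = h' := by
    rw [reassoc_of% Γ.trivUnit_trivMap, trivUnit_trivInv, Category.comp_id]
  have hyρ : y ≫ ρ = Γ.trivStr x hx := by
    rw [Category.assoc, trivInv_comp, trivMap_str, Category.comp_id]
  have hy₀ : Γ.trivMap hQ hx n.q₀ m.q₀ (n.mapQ_q₀ m sq.w).symm ≫ y = y' ≫ o.q₀ := by
    rw [Category.assoc, ← trivMap_trivInv hoQ htρ o.q₀ m.q₀ (o.mapQ_q₀ m sqR.w).symm,
      reassoc_of% Γ.trivMap_comp, reassoc_of% Γ.trivMap_comp,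
      Γ.trivMap_congr _ _ _ (n.mapQ_q₀ o hh'.symm).symm
        (show m.q₀ ≫ 𝟙 E = 𝟙 m.Q ≫ m.q₀ by simp)]
  have hy₁ : Γ.trivMap hQ hx n.q₁ m.q₁ (n.mapQ_q₁ m sq.w).symm ≫ y = y' ≫ o.q₁ := by
    rw [Category.assoc, ← trivMap_trivInv hoQ htρ o.q₁ m.q₁ (o.mapQ_q₁ m sqR.w).symm,
      reassoc_of% Γ.trivMap_comp, reassoc_of% Γ.trivMap_comp,
      Γ.trivMap_congr _ _ _ (n.mapQ_q₁ o hh'.symm).symm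
        (show m.q₁ ≫ 𝟙 E = 𝟙 m.Q ≫ m.q₁ by simp)]
  obtain ⟨l, ⟨hl, hlγ⟩, huniq⟩ := univ γ (y ≫ r) hγ.1.1
    (by rw [Category.assoc, sqR.w, reassoc_of% hyρ])
    (by rw [reassoc_of% hy₀, reassoc_of% hy₁, o.isPullback_Q.w])
  refine ⟨l, ⟨?_, hlγ⟩, ?_⟩
  -- Both `u ≫ l` and `h` are morphisms over `B` out of `A`, so it suffices that they agree after
  -- precomposition with `b`.
  · refine (hp.existsUnique_desc hf.1 sq n hγ.1.1 (b ≫ h) (by rw [Category.assoc, hh])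
      (by rw [reassoc_of% n.isPullback_Q.w])).unique ⟨?_, ?_⟩ ⟨rfl, hh⟩
    · rw [reassoc_of% hu, hl, reassoc_of% hy, hh']
    · rw [Category.assoc, hlγ, hu']
  · rintro l' ⟨hl', hlγ'⟩
    refine huniq l' ⟨?_, hlγ'⟩
    -- The base change of `l'` along `p`. It equals `y`, since both restrict to `h'` on `P` and `ρ`
    -- is trivial.
    let z : Γ.trivObj x hx ⟶ R := sqR.lift (ν ≫ l') (Γ.trivStr x hx) (by
      rw [Category.assoc, hlγ', hN.w])
    have hz : z ≫ r = ν ≫ l' := sqR.lift_fst _ _ _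
    have hz' : z ≫ ρ = Γ.trivStr x hx := sqR.lift_snd _ _ _
    rw [← hz]
    congr 1
    refine trivObj_hom_ext hadm hx hs htρ (hz'.trans hyρ.symm) ?_
    rw [hy]
    apply sqR.hom_ext
    · rw [Category.assoc, hz, ← reassoc_of% hu, hl', hh']
    · rw [Category.assoc, hz', trivUnit_str, hh'']

end

/-! ### From universal arrows to the two adjunctions. -/

theorem isRightAdjoint_of_exists_universal {D₁ D₂ : Type*} [Category* D₁] [Category* D₂]
    (G : D₁ ⥤ D₂)
    (h : ∀ A : D₂, ∃ (N : D₁) (u : A ⟶ G.obj N), ∀ (Y : D₁) (k : A ⟶ G.obj Y),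
      ∃! l : N ⟶ Y, u ≫ G.map l = k) : G.IsRightAdjoint := by
  rw [isRightAdjoint_iff_hasInitial_structuredArrow]
  intro A
  obtain ⟨N, u, hu⟩ := h A
  have (Z : StructuredArrow A G) : Unique (StructuredArrow.mk u ⟶ Z) :=
    { default := StructuredArrow.homMk (hu Z.right Z.hom).choose (hu Z.right Z.hom).choose_spec.1
      uniq := fun l => StructuredArrow.hom_ext _ _
        ((hu Z.right Z.hom).choose_spec.2 l.right (StructuredArrow.w l)) }
  exact hasInitial_of_unique (StructuredArrow.mk u)

theorem normalExt.of_isPullback (hadm : Γ.split.IsAdmissible)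
    (hM : Γ.monadicExt.IsStableUnderBaseChange) {A B A' B' : C} {f : A ⟶ B} (hf : Γ.normalExt f)
    {a : A' ⟶ A} {f' : A' ⟶ B'} {k : B' ⟶ B} (sq : IsPullback a f' f k) : Γ.normalExt f' := by
  refine normalExt.of_isPullback_self (hM.of_isPullback sq hf.1) ?_
  intro P c d hP
  have h₁ : IsPullback (c ≫ a) d f (f' ≫ k) := (hP.flip.paste_vert sq.flip).flip
  -- The kernel pair projection `d` of `f'` is a pullback of `f` along `f' ≫ k`, which factors
  -- through `f` as `a ≫ f`.
  exact (hf.isSplitEpi_and_trivialExt hadm sq.w h₁).2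

end GaloisStructure

open GaloisStructure in
theorem proposition3p4 {C : Type u₁} [Category.{v₁} C] {X : Type u₂} [Category.{v₂} X]
    (Γ : GaloisStructure C X) (hI : Γ.PreservesSplitPullbacks) (hadm : Γ.split.IsAdmissible) :
    (∀ B : C, (∃ p : Γ.MExtOver B, Γ.IsWeaklyUniversal p) → (Γ.inclOver B).IsRightAdjoint) ∧
    ((∀ B : C, ∃ p : Γ.MExtOver B, Γ.IsWeaklyUniversal p) →
      Γ.monadicExt.IsStableUnderBaseChange → Γ.incl.IsRightAdjoint) := by
  constructor
  · rintro B ⟨p, hp⟩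
    apply isRightAdjoint_of_exists_universal
    intro f
    obtain ⟨e⟩ := hp f
    obtain ⟨N, g, u, hg, hu, univ⟩ := exists_normal_reflection hI hadm f.property p.property
      e.hom.left (Over.w e.hom)
    refine ⟨⟨Over.mk g, hg⟩, ObjectProperty.homMk (Over.homMk u hu), ?_⟩
    intro G h
    obtain ⟨l, ⟨hl, hl'⟩, huniq⟩ := univ G.obj.hom h.hom.left G.property (Over.w h.hom)
    refine ⟨ObjectProperty.homMk (Over.homMk l hl'), ?_, ?_⟩
    · ext
      exact hl
    · intro l' h'
      ext
      exact huniq _ ⟨congrArg (fun m => m.hom.left) h', Over.w l'.hom⟩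
  · intro hw hM
    apply isRightAdjoint_of_exists_universal
    intro f
    obtain ⟨p, hp⟩ := hw f.obj.right
    obtain ⟨e⟩ := hp ⟨Over.mk f.obj.hom, f.property⟩
    obtain ⟨N, g, u, hg, hu, univ⟩ := exists_normal_reflection hI hadm f.property p.property
      e.hom.left (Over.w e.hom)
    -- The reflection within a fixed codomain also serves in the arrow category: its unit is the
    -- identity on codomains.
    refine ⟨⟨Arrow.mk g, hg⟩, ObjectProperty.homMk (Arrow.homMk u (𝟙 _)
      (hu.trans (Category.comp_id _).symm)), ?_⟩
    intro G h
    -- Pulling the target back along the codomain component of `h` reduces to the universal property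
    -- over a fixed base.
    obtain ⟨G', c, γ, sq⟩ := Γ.exists_isPullback G.property.1.1 h.hom.right
    have hγ : Γ.normalExt γ := G.property.of_isPullback hadm hM sq
    obtain ⟨l, ⟨hl, hl'⟩, huniq⟩ := univ γ (sq.lift h.hom.left f.obj.hom (Arrow.w h.hom)) hγ
      (sq.lift_snd _ _ _)
    refine ⟨ObjectProperty.homMk (Arrow.homMk (l ≫ c) h.hom.right
      (show (l ≫ c) ≫ G.obj.hom = g ≫ h.hom.right by rw [Category.assoc, sq.w, reassoc_of% hl'])),
      ?_, ?_⟩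
    · ext
      · change u ≫ l ≫ c = h.hom.left
        rw [reassoc_of% hl, sq.lift_fst]
      · exact Category.id_comp _
    · intro l' h'
      have h₁ : u ≫ l'.hom.left = h.hom.left := congrArg (fun m => m.hom.left) h'
      have h₂ : l'.hom.right = h.hom.right :=
        (Category.id_comp _).symm.trans (congrArg (fun m => m.hom.right) h')
      have h₃ : l'.hom.left ≫ G.obj.hom = g ≫ h.hom.right :=
        (Arrow.w l'.hom).trans (congrArg _ h₂)
      have h₄ := huniq (sq.lift l'.hom.left g h₃) ⟨by
        apply sq.hom_ext
        · rw [Category.assoc, sq.lift_fst, sq.lift_fst, h₁]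
        · rw [Category.assoc, sq.lift_snd, sq.lift_snd, hu], sq.lift_snd _ _ _⟩
      ext
      · change l'.hom.left = l ≫ c
        rw [← h₄, sq.lift_fst]
      · exact h₂
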